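/- Let $d\ge 1$ and let $(X_n)_{n\in\mathbb N}$ be random vectors in $\mathbb R^d$. Let $-\infty\le a^{(i)}<0<b^{(i)}\le+\infty$ for $1\le i\le d$, and let $\mathcal S=\{z\in\mathbb C^d : a^{(i)}<\mathrm{Re}(z^{(i)})<b^{(i)}\ \text{for all } i\}$. Suppose that $(X_n)$ is mod-Gaussian convergent in the Laplace sense on $\mathcal S$ with parameters $t_nI_d$, $t_n\to+\infty$, and limiting function $\psi$. This means that, for every $n$ and $z\in\mathcal S$, $\exp(\sum_i z^{(i)}X_n^{(i)})$ is integrable, and that $$\psi_n(z)=\mathbb E\big[e^{\sum_i z^{(i)}X_n^{(i)}}\big]\,e^{-\frac{t_n}{2}\sum_i (z^{(i)})^2}\longrightarrow\psi(z)$$ locally uniformly on $\mathcal S$, where $\psi$ is continuous on $\mathcal S$ and $\psi(0)=1$. Suppose moreover that $\psi$ does not vanish on the real part $\prod_{i}(a^{(i)},b^{(i)})$ of $\mathcal S$. Let $K$ be a compact subset of $\prod_{i}(a^{(i)},b^{(i)})\setminus\{0\}$ and let $M\in\mathbb{R}$. For $h\in K$ and a Borel convex set $D_0\subset h^\perp$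 such that $\|x\|\le M$ for all $x\in D_0$, let $C=\{r(h+x) : r\ge 1,\ x\in D_0\}$ be the cone based on $D_0+h$. Then $$(2\pi)^{\frac d2}\,e^{\frac{t_n\|h\|^2}{2}}\,\frac{1}{\psi_n(h)}\,\mathbb P[X_n\in t_nC] =(t_n)^{\frac d2-1}\int_{D_0}\Big(1+\frac{\langle\nabla\psi(h),x\rangle}{\psi(h)}+r_n(h,x)\Big)\frac{\|h\|\,e^{-\frac{t_n\|x\|^2}{2}}}{\|h\|^2+\|x\|^2}\,dx+\varepsilon_n(h,D_0),$$ where $dx$ is Lebesgue measure on the Euclidean space $h^\perp$, $r_n(h,x)=O(1/t_n)$ and $\varepsilon_n(h,D_0)=o(1/\sqrt{t_n})$, uniformly in $h$, $x$ and $D_0$. More precisely, there are a constant $c$, real functions $r_n(h,x)$ that are Borel in $x$ and do not depend on $D_0$, and a sequence $\delta_n\to0$, all depending only on $K$, $M$ and the sequence $(X_n)$ (with its parameters $t_n$ and limiting function $\psi$), such that for all $n$ large enough (depending only on the same data), $|r_n(h,x)|\le c/t_n$ and $|\varepsilon_n(h,D_0)|\le\delta_n/\sqrt{t_n}$ for all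 $h\in K$, all $x\in h^\perp$ with $\|x\|\le M$, and all $D_0$ as above. -/

import Mathlib

open MeasureTheory Filter Topology
open scoped Pointwise

noncomputable section

/-- The residue `ψ(z) = 𝔼[exp ⟨z, X⟩] * exp (-t * (zᵀ A z) / 2)`, `z ∈ ℂ^d`, of a random vector `X`
in `ℝ^d` with respect to the covariance `t A`; here `⟨z, x⟩ = ∑ i, z i * x i` is bilinear. -/
def laplaceResidue {d : ℕ} {Ω : Type*} [MeasurableSpace Ω] (P : Measure Ω)
    (X : Ω → EuclideanSpace ℝ (Fin d)) (t : ℝ) (A : Matrix (Fin d) (Fin d) ℝ)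
    (z : Fin d → ℂ) : ℂ :=
  (∫ ω, Complex.exp (∑ i, z i * (X ω i : ℂ)) ∂P) *
    Complex.exp (-((t : ℂ) * (z ⬝ᵥ (A.map Complex.ofReal).mulVec z) / 2))

/-- The multi-strip `{z ∈ ℂ^d | ∀ i, a i < Re (z i) < b i}`, with bounds in `[-∞, +∞]`. -/
def multiStrip {d : ℕ} (a b : Fin d → EReal) : Set (Fin d → ℂ) :=
  {z | ∀ i, a i < ((z i).re : EReal) ∧ ((z i).re : EReal) < b i}

/-- The real part `∏ i, (a i, b i)` of the multi-strip. -/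
def realBox {d : ℕ} (a b : Fin d → EReal) : Set (EuclideanSpace ℝ (Fin d)) :=
  {x | ∀ i, a i < (x i : EReal) ∧ (x i : EReal) < b i}

/-- A real vector seen as a complex vector. -/
def toComplexVec {d : ℕ} (x : EuclideanSpace ℝ (Fin d)) : Fin d → ℂ := fun i => (x i : ℂ)

/-- Mod-Gaussian convergence in the Laplace sense on the multi-strip `multiStrip a b`, with
parameters `t n • A` and limiting function `ψ` (whose values off the multi-strip are irrelevant).
The random vectors may be defined on different probability spaces. -/
structure IsModGaussian {d : ℕ} {Ω : ℕ → Type*} [∀ n, MeasurableSpace (Ω n)]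
    (P : ∀ n, Measure (Ω n)) (X : ∀ n, Ω n → EuclideanSpace ℝ (Fin d))
    (t : ℕ → ℝ) (A : Matrix (Fin d) (Fin d) ℝ) (a b : Fin d → EReal)
    (ψ : (Fin d → ℂ) → ℂ) : Prop where
  posDef : A.PosDef
  tendsto_param : Tendsto t atTop atTop
  integrable : ∀ n, ∀ z ∈ multiStrip a b,
    Integrable (fun ω => Complex.exp (∑ i, z i * (X n ω i : ℂ))) (P n)
  continuousOn : ContinuousOn ψ (multiStrip a b)
  map_zero : ψ 0 = 1
  tendsto_residue : TendstoLocallyUniformlyOn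
    (fun n z => laplaceResidue (P n) (X n) (t n) A z) ψ atTop (multiStrip a b)

/-- `⟨∇ψ(z), x⟩ = ∑ i, (∂ψ/∂z_i)(z) * x i`, with complex partial derivatives. -/
def gradPairing {d : ℕ} (ψ : (Fin d → ℂ) → ℂ) (z : Fin d → ℂ)
    (x : EuclideanSpace ℝ (Fin d)) : ℂ :=
  ∑ i, fderiv ℂ ψ z (Pi.single i 1) * (x i : ℂ)

/-- The cone `[1, ∞) × D = {r y | r ≥ 1, y ∈ D}`. -/
def coneOver {E : Type*} [AddCommGroup E] [Module ℝ E] (D : Set E) : Set E :=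
  {x | ∃ r : ℝ, 1 ≤ r ∧ ∃ y ∈ D, x = r • y}

/-- Lebesgue measure of the Euclidean subspace `h^⊥`, seen as a measure on the ambient space: it is
the push-forward by the inclusion of the Haar measure of `h^⊥` that gives mass one to the cube
spanned by an orthonormal basis. -/
def perpMeasure {d : ℕ} (h : EuclideanSpace ℝ (Fin d)) : Measure (EuclideanSpace ℝ (Fin d)) :=
  Measure.map (Subtype.val : (ℝ ∙ h)ᗮ → EuclideanSpace ℝ (Fin d))
    (stdOrthonormalBasis ℝ (ℝ ∙ h)ᗮ).toBasis.addHaar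

end

/-! At the precision `o(1/√t)` only the leading term matters. On the hyperplane the Gaussian weight
lives at scale `‖x‖ ~ 1/√t`, so after the substitution `x = w/√t` the main term is `(√t)⁻¹ ‖h‖⁻¹ ∫
exp (-‖w‖²/2) dw` over `√t D₀`. The gradient term and the replacement of `‖h‖² + ‖x‖²` by `‖h‖²`
change it only by `O(1/t)` (`norm_mainTerm_sub_le`). Hence `r = 0` is an admissible correction, and
the task is to find the leading term of the probability, uniformly in `h` and in the convex base.

Tilt the law of `X` by `exp ⟨h, X⟩` and use the coordinates `s = ⟨h, X⟩ - t‖h‖²` and `w` =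
(orthogonal part of `X`)/`√t`. The left side becomes `(2π)^(d/2)` times the integral of `exp (-s)`
over a convex truncated cone of slope `1/(t‖h‖²)` (`residue_mul_measureReal_cone`). The
characteristic function of `(s, w)` is that of a centred Gaussian with deviations `√t‖h‖` and `1`,
times a ratio of residues at `h + iζ` and `h` (`jointCharFun_tiltedLaw`); this ratio tends to one as
`ζ → 0`.

What is needed is thus a local limit theorem in `s`, at unit scale, joint with a central limit
theorem in `w`, uniform over convex sets (`tendsto_mul_setIntegral_exp_neg_sub`). Reweight the law
by a positive `kernel` in `s` whose Fourier transform has compact support: only bounded frequencies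
then matter, and the normalized measures converge weakly to kernel times Gaussian. Since the kernel
decays only quadratically, `exp (-s)` divided by it is bounded and continuous on `s ≥ 0`, so it
serves as a test function. Weak convergence to an absolutely continuous limit is uniform over convex
sets, because bounded convex sets are precompact for the Hausdorff distance and their frontiers are
null. Finally the slope tends to zero, so the cone has nearly the Gaussian mass of its base
(`tendsto_setIntegral_truncatedCone_sub`).

Uniformity comes from contradiction: a bad sequence `(n, h, D)` has a subsequence with `h`
convergent in `K`, and the limit theorems allow the sets to vary with the index. -/

set_option linter.unusedSectionVars false

/-! ### Hausdorff limits of convex sets, with inner and outer bump functions -/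

section ConvexSets

variable {G : Type*} [NormedAddCommGroup G] [InnerProductSpace ℝ G]

/-- A cancellation property of closed convex sets: if a closed ball is contained in a small
neighbourhood of such a set, then the set contains a slightly smaller ball. -/
theorem ball_subset_of_forall_infDist_lt [FiniteDimensional ℝ G] {S : Set G} (hS : Convex ℝ S)
    (hcl : IsClosed S) (hne : S.Nonempty) {x : G} {δ δ' : ℝ} (hδ' : 0 ≤ δ')
    (h : ∀ p ∈ Metric.closedBall x δ, Metric.infDist p S ≤ δ') :
    Metric.ball x (δ - δ') ⊆ S := by
  intro p hp
  by_contra hpS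
  obtain ⟨q, hq, hmin⟩ := exists_norm_eq_iInf_of_complete_convex hne hcl.isComplete hS p
  rw [norm_eq_iInf_iff_real_inner_le_zero hS hq] at hmin
  have hpq : p - q ≠ 0 := fun h0 => hpS (by rwa [sub_eq_zero.1 h0])
  have hpos : 0 < ‖p - q‖ := norm_pos_iff.2 hpq
  -- Moving from `p` by `δ'` along the outward normal at its projection `q` stays in the closed
  -- ball, yet reaches distance at least `‖p - q‖ + δ'` from `S`, by the supporting hyperplane at
  -- `q`.
  set v : G := (‖p - q‖)⁻¹ • (p - q) with hv
  have hv1 : ‖v‖ = 1 := by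
    rw [hv, norm_smul, norm_inv, norm_norm, inv_mul_cancel₀ hpos.ne']
  have hmem : p + δ' • v ∈ Metric.closedBall x δ := by
    rw [Metric.mem_closedBall, dist_eq_norm]
    rw [Metric.mem_ball, dist_eq_norm] at hp
    calc ‖p + δ' • v - x‖ = ‖(p - x) + δ' • v‖ := by congr 1; abel
      _ ≤ ‖p - x‖ + ‖δ' • v‖ := norm_add_le _ _
      _ ≤ (δ - δ') + δ' := by
          rw [norm_smul, hv1, Real.norm_of_nonneg hδ', mul_one]; linarith
      _ = δ := by ring
  have hle : ‖p - q‖ + δ' ≤ Metric.infDist (p + δ' • v) S := by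
    rw [Metric.le_infDist hne]
    intro y hy
    have h1 : inner ℝ v (p + δ' • v - y) = ‖p - q‖ + δ' - (‖p - q‖)⁻¹ * inner ℝ (p - q) (y - q) := by
      have : p + δ' • v - y = (p - q) + δ' • v - (y - q) := by abel
      rw [this, inner_sub_right, inner_add_right, real_inner_smul_right,
        real_inner_self_eq_norm_sq, hv1, hv, real_inner_smul_left, real_inner_smul_left,
        real_inner_self_eq_norm_sq]
      field_simp
    have h2 : inner ℝ v (p + δ' • v - y) ≤ ‖p + δ' • v - y‖ := by
      simpa [hv1] using real_inner_le_norm v (p + δ' • v - y)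
    have h3 : (‖p - q‖)⁻¹ * inner ℝ (p - q) (y - q) ≤ 0 :=
      mul_nonpos_of_nonneg_of_nonpos (by positivity) (hmin y hy)
    rw [dist_eq_norm]
    linarith
  linarith [h _ hmem]

/-- In finite dimension a convex set with dense trace on a ball spans the whole space, so it has an
interior point `y`. Then `x` lies strictly between `y` and a point of the closure just beyond `x`,
hence in the interior. This permits bases that are not closed. -/
theorem Convex.mem_of_ball_subset_closure [FiniteDimensional ℝ G] {S : Set G} (hS : Convex ℝ S)
    {x : G} {r : ℝ} (hr : 0 < r) (h : Metric.ball x r ⊆ closure S) : x ∈ S := by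
  have hxi : x ∈ interior (closure S) :=
    mem_interior.2 ⟨_, h, Metric.isOpen_ball, Metric.mem_ball_self hr⟩
  have hspan : affineSpan ℝ S = ⊤ := by
    have h1 : closure S ⊆ affineSpan ℝ S :=
      closure_minimal (subset_affineSpan ℝ S) (AffineSubspace.closed_of_finiteDimensional _)
    have h2 : affineSpan ℝ (closure S) = ⊤ :=
      (hS.closure.interior_nonempty_iff_affineSpan_eq_top).1 ⟨x, hxi⟩
    exact top_le_iff.1 (h2 ▸ affineSpan_le.2 h1)
  obtain ⟨y, hy⟩ := hS.interior_nonempty_iff_affineSpan_eq_top.2 hspan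
  by_cases hxy : y = x
  · exact hxy ▸ interior_subset hy
  -- extend the segment from `y` to `x` slightly beyond `x`
  have hpos : 0 < ‖x - y‖ := norm_pos_iff.2 (sub_ne_zero.2 (Ne.symm hxy))
  set c : ℝ := r / (2 * ‖x - y‖) with hc
  have hc0 : 0 < c := by positivity
  have hz : x + c • (x - y) ∈ closure S := by
    apply h
    rw [Metric.mem_ball, dist_eq_norm, add_sub_cancel_left, norm_smul, Real.norm_of_nonneg hc0.le,
      hc]
    field_simp
    linarith
  have hcomb := hS.combo_interior_closure_mem_interior hy hz (a := c / (1 + c)) (b := 1 / (1 + c))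
    (by positivity) (by positivity) (by field_simp; ring)
  have : (c / (1 + c)) • y + (1 / (1 + c)) • (x + c • (x - y)) = x := by
    have h1 : (1 + c) ≠ 0 := by positivity
    match_scalars <;> field_simp
    ring
  rw [this] at hcomb
  exact interior_subset hcomb

open TopologicalSpace in
-- The distance to a convex set is a convex function of the point, and distances to the sets
-- converge along a Hausdorff limit.
theorem convex_of_tendsto_nonemptyCompacts {C : ℕ → NonemptyCompacts G} {C₀ : NonemptyCompacts G}
    (hC : Tendsto C atTop (𝓝 C₀)) (hconv : ∀ k, Convex ℝ (C k : Set G)) :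
    Convex ℝ (C₀ : Set G) := by
  have hlim : ∀ x, Tendsto (fun k => Metric.infDist x (C k : Set G)) atTop
      (𝓝 (Metric.infDist x C₀)) := fun x =>
    ((Metric.lipschitz_infDist_set x).continuous.tendsto C₀).comp hC
  intro x hx y hy a b ha hb hab
  rw [C₀.isCompact.isClosed.mem_iff_infDist_zero C₀.nonempty]
  refine le_antisymm ?_ Metric.infDist_nonneg
  have h0 : Tendsto (fun k => a * Metric.infDist x (C k : Set G) + b * Metric.infDist y (C k : Set G))
      atTop (𝓝 0) := by
    have := ((hlim x).const_mul a).add ((hlim y).const_mul b)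
    rwa [Metric.infDist_zero_of_mem hx, Metric.infDist_zero_of_mem hy, mul_zero, mul_zero,
      add_zero] at this
  refine le_of_tendsto_of_tendsto' (hlim _) h0 fun k => ?_
  obtain ⟨x', hx', hxe⟩ := (C k).isCompact.exists_infDist_eq_dist (C k).nonempty x
  obtain ⟨y', hy', hye⟩ := (C k).isCompact.exists_infDist_eq_dist (C k).nonempty y
  rw [hxe, hye]
  refine (Metric.infDist_le_dist_of_mem (hconv k hx' hy' ha hb hab)).trans ?_
  rw [dist_eq_norm, dist_eq_norm, dist_eq_norm]
  calc ‖a • x + b • y - (a • x' + b • y')‖ = ‖a • (x - x') + b • (y - y')‖ := by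
        congr 1; module
    _ ≤ ‖a • (x - x')‖ + ‖b • (y - y')‖ := norm_add_le _ _
    _ = _ := by rw [norm_smul, norm_smul, Real.norm_of_nonneg ha, Real.norm_of_nonneg hb]

/-- A continuous function equal to one at distance at most `δ` from `C`, and supported at distance
at most `2 δ` from `C`. -/
noncomputable def outerBump (C : Set G) (δ : ℝ) (x : G) : ℝ :=
  max 0 (min 1 (2 - Metric.infDist x C / δ))

/-- A continuous function supported at distance at least `δ` from the complement of `C`, and equal
to one at distance at least `2 δ` from the complement. -/
noncomputable def innerBump (C : Set G) (δ : ℝ) (x : G) : ℝ :=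
  max 0 (min 1 (Metric.infDist x Cᶜ / δ - 1))

theorem continuous_outerBump (C : Set G) (δ : ℝ) : Continuous (outerBump C δ) := by
  unfold outerBump
  have := Metric.continuous_infDist_pt C
  fun_prop

theorem continuous_innerBump (C : Set G) (δ : ℝ) : Continuous (innerBump C δ) := by
  unfold innerBump
  have := Metric.continuous_infDist_pt Cᶜ
  fun_prop

theorem outerBump_mem_Icc (C : Set G) (δ : ℝ) (x : G) : outerBump C δ x ∈ Set.Icc (0 : ℝ) 1 :=
  ⟨le_max_left _ _, max_le zero_le_one (min_le_left _ _)⟩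

theorem innerBump_mem_Icc (C : Set G) (δ : ℝ) (x : G) : innerBump C δ x ∈ Set.Icc (0 : ℝ) 1 :=
  ⟨le_max_left _ _, max_le zero_le_one (min_le_left _ _)⟩

/-- The bumps of widths `1 / (j + 1)` have the same limit off the frontier of `C`. -/
theorem tendsto_outerBump_sub_innerBump {C : Set G} (hC : IsClosed C) (hne : C.Nonempty)
    (hne' : Cᶜ.Nonempty) {x : G} (hx : x ∉ frontier C) :
    Tendsto (fun j : ℕ => outerBump C (1 / ((j : ℝ) + 1)) x - innerBump C (1 / ((j : ℝ) + 1)) x)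
      atTop (𝓝 0) := by
  have hj : ∀ c : ℝ, 0 < c → ∀ᶠ j : ℕ in atTop, 2 ≤ c / (1 / ((j : ℝ) + 1)) := by
    intro c hc
    obtain ⟨N, hN⟩ := exists_nat_gt (2 / c)
    filter_upwards [eventually_ge_atTop N] with j hjN
    have : (N : ℝ) ≤ j := by exact_mod_cast hjN
    rw [div_lt_iff₀ hc] at hN
    rw [div_div_eq_mul_div, div_one]
    nlinarith
  -- Off the frontier the two bumps are eventually equal: both are one at interior points and both
  -- are zero outside `C`.
  refine tendsto_const_nhds.congr' ?_
  by_cases hxC : x ∈ C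
  · have hxi : x ∈ interior C := by
      by_contra h
      exact hx ⟨subset_closure hxC, h⟩
    have hpos : 0 < Metric.infDist x Cᶜ := by
      rw [← Metric.infDist_pos_iff_notMem_closure hne'] 
      rw [closure_compl]; simpa using hxi
    filter_upwards [hj _ hpos] with j h2
    rw [outerBump, innerBump, Metric.infDist_zero_of_mem hxC, min_eq_left (by simp),
      min_eq_left (by linarith)]
    simp
  · have hpos : 0 < Metric.infDist x C := by
      rwa [← Metric.infDist_pos_iff_notMem_closure hne, hC.closure_eq]
    filter_upwards [hj _ hpos] with j h2
    have hz : Metric.infDist x Cᶜ = 0 := Metric.infDist_zero_of_mem hxC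
    rw [outerBump, innerBump, hz, max_eq_left ((min_le_right _ _).trans (by linarith)),
      max_eq_left ((min_le_right _ _).trans (by simp))]
    simp

open TopologicalSpace in
/-- Convex sets whose closures converge to `C₀` are eventually squeezed between the bumps
of `C₀`. -/
theorem eventually_innerBump_le_indicator_le_outerBump [FiniteDimensional ℝ G] {B : ℕ → Set G}
    (hB : ∀ k, Convex ℝ (B k)) {C : ℕ → NonemptyCompacts G}
    (hBC : ∀ k, (C k : Set G) = closure (B k)) {C₀ : NonemptyCompacts G}
    (hC : Tendsto C atTop (𝓝 C₀)) {δ : ℝ} (hδ : 0 < δ) :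
    ∀ᶠ k in atTop, ∀ x, innerBump (C₀ : Set G) δ x ≤ (B k).indicator (fun _ => (1 : ℝ)) x ∧
      (B k).indicator (fun _ => (1 : ℝ)) x ≤ outerBump (C₀ : Set G) δ x := by
  have hd : ∀ᶠ k in atTop, dist (C k) C₀ < δ / 2 :=
    (Metric.tendsto_nhds.1 hC) (δ / 2) (by positivity)
  filter_upwards [hd] with k hk x
  rw [Metric.NonemptyCompacts.dist_eq] at hk
  have hfin : Metric.hausdorffEDist (C k : Set G) (C₀ : Set G) ≠ ⊤ :=
    Metric.hausdorffEDist_ne_top_of_nonempty_of_bounded (C k).nonempty C₀.nonempty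
      (C k).isCompact.isBounded C₀.isCompact.isBounded
  constructor
  · by_cases hx : x ∈ B k
    · rw [Set.indicator_of_mem hx]
      exact (innerBump_mem_Icc _ _ _).2
    · rw [Set.indicator_of_notMem hx]
      refine max_le le_rfl ((min_le_right _ _).trans ?_)
      by_contra! hlt
      have hlt' : δ < Metric.infDist x (C₀ : Set G)ᶜ := by
        rw [sub_pos, lt_div_iff₀ hδ] at hlt
        linarith
      -- A point deeper than `δ` inside `C₀` has its closed `δ`-ball in `C₀`, hence within `δ / 2`
      -- of `C k`. By cancellation `C k` contains the ball of radius `δ / 2`, which forces `x ∈ B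
      -- k`.
      have hball : ∀ p ∈ Metric.closedBall x δ, Metric.infDist p (C k : Set G) ≤ δ / 2 := by
        intro p hp
        have hp0 : p ∈ (C₀ : Set G) := Metric.ball_infDist_compl_subset
          (Metric.closedBall_subset_ball hlt' hp)
        have := Metric.infDist_le_hausdorffDist_of_mem hp0
          (by rwa [Metric.hausdorffEDist_comm] at hfin)
        rw [Metric.hausdorffDist_comm] at this
        linarith
      have hCk : Convex ℝ (C k : Set G) := hBC k ▸ (hB k).closure
      have hsub := ball_subset_of_forall_infDist_lt hCk (C k).isCompact.isClosed (C k).nonempty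
        (by positivity) hball
      rw [hBC k] at hsub
      exact hx ((hB k).mem_of_ball_subset_closure (by linarith) hsub)
  · by_cases hx : x ∈ B k
    · rw [Set.indicator_of_mem hx]
      have hxC : x ∈ (C k : Set G) := hBC k ▸ subset_closure hx
      have h1 := Metric.infDist_le_hausdorffDist_of_mem hxC hfin
      refine le_max_of_le_right (le_min le_rfl ?_)
      have : Metric.infDist x (C₀ : Set G) / δ ≤ 1 := by
        rw [div_le_one hδ]; linarith
      linarith
    · rw [Set.indicator_of_notMem hx]
      exact (outerBump_mem_Icc _ _ _).1

end ConvexSets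

/-! ### Weak convergence is uniform over convex sets -/

section ConvexConvergence

variable {G : Type*} [NormedAddCommGroup G] [InnerProductSpace ℝ G] [FiniteDimensional ℝ G]
  [MeasurableSpace G] [BorelSpace G]

theorem tendsto_integral_of_tendsto_probabilityMeasure {μ : ℕ → ProbabilityMeasure G}
    {μ₀ : ProbabilityMeasure G} (hμ : Tendsto μ atTop (𝓝 μ₀)) {g : G → ℝ} (hg : Continuous g)
    {c : ℝ} (hgc : ∀ x, |g x| ≤ c) :
    Tendsto (fun k => ∫ x, g x ∂(μ k : Measure G)) atTop (𝓝 (∫ x, g x ∂(μ₀ : Measure G))) :=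
  (ProbabilityMeasure.tendsto_iff_forall_integral_tendsto.1 hμ)
    (BoundedContinuousFunction.ofNormedAddCommGroup g hg c hgc)

/-- Polya-type theorem for bounded convex sets, along a sequence with convergent closures. -/
theorem tendsto_setIntegral_sub_of_tendsto_closure [Nontrivial G] {μ : ℕ → ProbabilityMeasure G}
    {μ₀ : ProbabilityMeasure G} (hμ : Tendsto μ atTop (𝓝 μ₀))
    (hac : (μ₀ : Measure G) ≪ volume) {f : G → ℝ} (hf : Continuous f) {c : ℝ}
    (hf0 : ∀ x, 0 ≤ f x) (hfc : ∀ x, f x ≤ c) {B : ℕ → Set G} (hB : ∀ k, Convex ℝ (B k))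
    (hBm : ∀ k, MeasurableSet (B k)) {C : ℕ → TopologicalSpace.NonemptyCompacts G}
    (hBC : ∀ k, (C k : Set G) = closure (B k)) {C₀ : TopologicalSpace.NonemptyCompacts G}
    (hC : Tendsto C atTop (𝓝 C₀)) :
    Tendsto (fun k => ∫ x in B k, f x ∂(μ k : Measure G) - ∫ x in B k, f x ∂(μ₀ : Measure G))
      atTop (𝓝 0) := by
  have hc : 0 ≤ c := (hf0 0).trans (hfc 0)
  have hconv : Convex ℝ (C₀ : Set G) :=
    convex_of_tendsto_nonemptyCompacts hC fun k => hBC k ▸ (hB k).closure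
  -- The distance to the empty set is zero by convention, which would make the inner bump vanish
  -- identically.
  have hCne : ((C₀ : Set G)ᶜ).Nonempty := by
    have : NoncompactSpace G := NormedSpace.noncompactSpace ℝ G
    exact Set.nonempty_compl.2 fun h => noncompact_univ G (h ▸ C₀.isCompact)
  set L : ℝ → G → ℝ := fun δ x => f x * innerBump (C₀ : Set G) δ x with hL
  set U : ℝ → G → ℝ := fun δ x => f x * outerBump (C₀ : Set G) δ x with hU
  have hLc : ∀ δ, Continuous (L δ) := fun δ => hf.mul (continuous_innerBump _ _)
  have hUc : ∀ δ, Continuous (U δ) := fun δ => hf.mul (continuous_outerBump _ _)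
  have hb : ∀ b ∈ Set.Icc (0 : ℝ) 1, ∀ x, |f x * b| ≤ c := by
    intro b hb x
    rw [abs_of_nonneg (mul_nonneg (hf0 x) hb.1)]
    nlinarith [hf0 x, hfc x, hb.1, hb.2]
  have hLb : ∀ δ x, |L δ x| ≤ c := fun δ x => hb _ (innerBump_mem_Icc _ _ _) x
  have hUb : ∀ δ x, |U δ x| ≤ c := fun δ x => hb _ (outerBump_mem_Icc _ _ _) x
  have hint : ∀ (ν : ProbabilityMeasure G) (g : G → ℝ), Measurable g → (∀ x, |g x| ≤ c) →
      Integrable g (ν : Measure G) := fun ν g hg hgc =>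
    Integrable.of_bound hg.aestronglyMeasurable c (Eventually.of_forall hgc)
  -- the sandwich for an arbitrary probability measure
  have hsand : ∀ δ : ℝ, 0 < δ → ∀ᶠ k in atTop, ∀ ν : ProbabilityMeasure G,
      ∫ x, L δ x ∂(ν : Measure G) ≤ ∫ x in B k, f x ∂(ν : Measure G) ∧
      ∫ x in B k, f x ∂(ν : Measure G) ≤ ∫ x, U δ x ∂(ν : Measure G) := by
    intro δ hδ
    filter_upwards [eventually_innerBump_le_indicator_le_outerBump hB hBC hC hδ] with k hk ν
    have hind : ∀ x, (B k).indicator f x = f x * (B k).indicator (fun _ => (1 : ℝ)) x := by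
      intro x
      by_cases hx : x ∈ B k <;> simp [hx]
    have hintB : Integrable ((B k).indicator f) (ν : Measure G) := by
      refine hint ν _ (hf.measurable.indicator (hBm k)) fun x => ?_
      rw [hind]
      refine hb _ ?_ x
      by_cases hx : x ∈ B k <;> simp [hx]
    rw [← integral_indicator (hBm k)]
    constructor
    · refine integral_mono (hint ν _ (hLc δ).measurable (hLb δ)) hintB fun x => ?_
      rw [hind]
      exact mul_le_mul_of_nonneg_left (hk x).1 (hf0 x)
    · refine integral_mono hintB (hint ν _ (hUc δ).measurable (hUb δ)) fun x => ?_
      rw [hind]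
      exact mul_le_mul_of_nonneg_left (hk x).2 (hf0 x)
  -- the gap between the two sides is small for the limiting measure
  have hgap : Tendsto (fun j : ℕ => ∫ x, U (1 / ((j : ℝ) + 1)) x ∂(μ₀ : Measure G) -
      ∫ x, L (1 / ((j : ℝ) + 1)) x ∂(μ₀ : Measure G)) atTop (𝓝 0) := by
    -- Frontiers of convex sets are Lebesgue null; absolute continuity of the limit enters here.
    have hfr : (μ₀ : Measure G) (frontier (C₀ : Set G)) = 0 := hac (hconv.addHaar_frontier volume)
    have hdom : Tendsto (fun j : ℕ => ∫ x, (U (1 / ((j : ℝ) + 1)) x - L (1 / ((j : ℝ) + 1)) x)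
        ∂(μ₀ : Measure G)) atTop (𝓝 (∫ x, (0 : ℝ) ∂(μ₀ : Measure G))) := by
      refine tendsto_integral_of_dominated_convergence (fun _ => 2 * c)
        (fun j => ((hUc _).sub (hLc _)).aestronglyMeasurable) (integrable_const _)
        (fun j => Eventually.of_forall fun x => ?_) ?_
      · calc ‖U (1 / ((j : ℝ) + 1)) x - L (1 / ((j : ℝ) + 1)) x‖ ≤ _ := norm_sub_le _ _
          _ ≤ c + c := add_le_add (hUb _ x) (hLb _ x)
          _ = 2 * c := by ring
      · have : ∀ᵐ x ∂(μ₀ : Measure G), x ∉ frontier (C₀ : Set G) := measure_eq_zero_iff_ae_notMem.1 hfr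
        filter_upwards [this] with x hx
        have := (tendsto_outerBump_sub_innerBump C₀.isCompact.isClosed C₀.nonempty hCne hx).const_mul
          (f x)
        simpa [hU, hL, mul_sub] using this
    rw [integral_zero] at hdom
    refine hdom.congr fun j => ?_
    exact integral_sub (hint μ₀ _ (hUc _).measurable (hUb _)) (hint μ₀ _ (hLc _).measurable (hLb _))
  rw [Metric.tendsto_nhds]
  intro ε hε
  obtain ⟨j, hj⟩ := ((Metric.tendsto_nhds.1 hgap) (ε / 2) (by positivity)).exists
  set δ : ℝ := 1 / ((j : ℝ) + 1) with hδ
  have hδ0 : 0 < δ := by positivity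
  rw [Real.dist_eq, sub_zero] at hj
  have hj' := (abs_lt.1 hj).2
  have h1 := (Metric.tendsto_nhds.1
    (tendsto_integral_of_tendsto_probabilityMeasure hμ (hUc δ) (hUb δ))) (ε / 2) (by positivity)
  have h2 := (Metric.tendsto_nhds.1
    (tendsto_integral_of_tendsto_probabilityMeasure hμ (hLc δ) (hLb δ))) (ε / 2) (by positivity)
  filter_upwards [hsand δ hδ0, h1, h2] with k hk hk1 hk2
  rw [Real.dist_eq] at hk1 hk2 ⊢
  obtain ⟨hk1a, hk1b⟩ := abs_lt.1 hk1
  obtain ⟨hk2a, hk2b⟩ := abs_lt.1 hk2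
  obtain ⟨ha, hb'⟩ := hk (μ k)
  obtain ⟨ha', hb''⟩ := hk μ₀
  rw [sub_zero, abs_lt]
  constructor <;> linarith

/-- Weak convergence to an absolutely continuous limit is uniform over convex sets. -/
theorem tendsto_setIntegral_convex_sub_of_tendsto_charFun [Nontrivial G]
    {μ : ℕ → ProbabilityMeasure G} {μ₀ : ProbabilityMeasure G}
    (hch : ∀ z : G, Tendsto (fun k => charFun (μ k : Measure G) z) atTop
      (𝓝 (charFun (μ₀ : Measure G) z)))
    (hac : (μ₀ : Measure G) ≪ volume) {f : G → ℝ} (hf : Continuous f) {c : ℝ}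
    (hf0 : ∀ x, 0 ≤ f x) (hfc : ∀ x, f x ≤ c) {B : ℕ → Set G} (hB : ∀ k, Convex ℝ (B k))
    (hBm : ∀ k, MeasurableSet (B k)) :
    Tendsto (fun k => ∫ x in B k, f x ∂(μ k : Measure G) - ∫ x in B k, f x ∂(μ₀ : Measure G))
      atTop (𝓝 0) := by
  have hμ : Tendsto μ atTop (𝓝 μ₀) := ProbabilityMeasure.tendsto_of_tendsto_charFun hch
  have hc : 0 ≤ c := (hf0 0).trans (hfc 0)
  have hint : ∀ (ν : ProbabilityMeasure G), Integrable f (ν : Measure G) := fun ν =>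
    Integrable.of_bound hf.aestronglyMeasurable c
      (Eventually.of_forall fun x => by rw [Real.norm_of_nonneg (hf0 x)]; exact hfc x)
  have htight : IsTightMeasureSet {ν : Measure G | ν ∈ insert (μ₀ : Measure G)
      {x | ∃ n, (μ n : Measure G) = x}} := by
    have h1 := isTightMeasureSet_of_tendsto_charFun (μ := fun n => (μ n : Measure G))
      (f := charFun (μ₀ : Measure G)) (by fun_prop) hch
    have h2 : IsTightMeasureSet ({(μ₀ : Measure G)} : Set (Measure G)) :=
      isTightMeasureSet_singleton
    exact h2.union h1
  rw [isTightMeasureSet_iff_exists_isCompact_measure_compl_le] at htight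
  rw [Metric.tendsto_nhds]
  intro ε hε
  -- Chosen so that `c * η ≤ ε / 4`, with `c + 1` in the denominator because `c` may be zero.
  -- Tightness then reduces the claim to subsets of one ball.
  set η : ℝ := ε / (4 * (c + 1)) with hη
  have hη0 : 0 < η := by positivity
  obtain ⟨K, hK, hKle⟩ := htight (ENNReal.ofReal η) (by simpa using hη0)
  obtain ⟨R, hR⟩ := hK.isBounded.subset_closedBall (0 : G)
  have hsmall : ∀ ν : ProbabilityMeasure G, (ν : Measure G) ∈ insert (μ₀ : Measure G)
      {x | ∃ n, (μ n : Measure G) = x} → ∀ A : Set G, MeasurableSet A →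
      |∫ x in A, f x ∂(ν : Measure G) -
        ∫ x in A ∩ Metric.closedBall 0 R, f x ∂(ν : Measure G)| ≤ ε / 4 := by
    intro ν hν A hA
    rw [← integral_inter_add_sdiff (s := A) (t := Metric.closedBall 0 R)
      Metric.isClosed_closedBall.measurableSet (hint ν).integrableOn, add_sub_cancel_left]
    have hle : (ν : Measure G).real (A \ Metric.closedBall 0 R) ≤ η := by
      refine ENNReal.toReal_le_of_le_ofReal hη0.le ((measure_mono ?_).trans (hKle _ hν))
      exact fun x hx hxK => hx.2 (hR hxK)
    calc |∫ x in A \ Metric.closedBall 0 R, f x ∂(ν : Measure G)|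
        ≤ c * (ν : Measure G).real (A \ Metric.closedBall 0 R) := by
          rw [← Real.norm_eq_abs]
          refine norm_setIntegral_le_of_norm_le_const (measure_lt_top (ν : Measure G) _) fun x _ => ?_
          rw [Real.norm_of_nonneg (hf0 x)]; exact hfc x
      _ ≤ c * η := mul_le_mul_of_nonneg_left hle hc
      _ ≤ ε / 4 := by
          rw [hη, mul_div_assoc', div_le_div_iff₀ (by positivity) (by positivity)]
          nlinarith
  have hmain : Tendsto (fun k => ∫ x in B k ∩ Metric.closedBall 0 R, f x ∂(μ k : Measure G) -
      ∫ x in B k ∩ Metric.closedBall 0 R, f x ∂(μ₀ : Measure G)) atTop (𝓝 0) := by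
    set A : ℕ → Set G := fun k => B k ∩ Metric.closedBall 0 R with hA
    have hAc : ∀ k, Convex ℝ (A k) := fun k => (hB k).inter (convex_closedBall _ _)
    have hAm : ∀ k, MeasurableSet (A k) := fun k =>
      (hBm k).inter Metric.isClosed_closedBall.measurableSet
    refine tendsto_of_subseq_tendsto fun ns hns => ?_
    -- The Hausdorff space contains only nonempty sets. If empty sets recur, both integrals vanish
    -- along that subsequence.
    by_cases hemp : ∃ᶠ j in atTop, A (ns j) = ∅
    · obtain ⟨ms, hms, hms'⟩ := extraction_of_frequently_atTop hemp
      refine ⟨ms, ?_⟩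
      change Tendsto (fun j => ∫ x in A (ns (ms j)), f x ∂(μ (ns (ms j)) : Measure G) -
        ∫ x in A (ns (ms j)), f x ∂(μ₀ : Measure G)) atTop (𝓝 0)
      simp [hms']
    · rw [not_frequently] at hemp
      obtain ⟨N, hN⟩ := eventually_atTop.1 hemp
      have hne : ∀ j, (A (ns (j + N))).Nonempty := fun j =>
        Set.nonempty_iff_ne_empty.2 (hN _ (Nat.le_add_left _ _))
      have hcl : ∀ j, closure (A (ns (j + N))) ⊆ Metric.closedBall 0 R := fun j =>
        closure_minimal Set.inter_subset_right Metric.isClosed_closedBall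
      let C : ℕ → TopologicalSpace.NonemptyCompacts G := fun j =>
        ⟨⟨closure (A (ns (j + N))), (isCompact_closedBall _ _).of_isClosed_subset isClosed_closure
          (hcl j)⟩, (hne j).closure⟩
      -- Blaschke selection: the nonempty compact subsets of a closed ball form a compact metric
      -- space.
      obtain ⟨C₀, -, ms, hms, hlim⟩ :=
        (TopologicalSpace.NonemptyCompacts.isCompact_subsets_of_isCompact
          (isCompact_closedBall (0 : G) R)).tendsto_subseq (x := C) hcl
      refine ⟨fun j => ms j + N, ?_⟩
      have hsub : Tendsto (fun j => ns (ms j + N)) atTop atTop :=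
        hns.comp ((tendsto_add_atTop_nat N).comp hms.tendsto_atTop)
      exact tendsto_setIntegral_sub_of_tendsto_closure (hμ.comp hsub) hac hf hf0 hfc
        (B := fun j => A (ns (ms j + N))) (fun j => hAc _) (fun j => hAm _)
        (C := fun j => C (ms j)) (fun j => rfl) hlim
  filter_upwards [(Metric.tendsto_nhds.1 hmain) (ε / 4) (by positivity)] with k hk
  have h1 := abs_le.1 (hsmall (μ k) (Set.mem_insert_of_mem _ ⟨k, rfl⟩) (B k) (hBm k))
  have h2 := abs_le.1 (hsmall μ₀ (Set.mem_insert _ _) (B k) (hBm k))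
  rw [Real.dist_eq, sub_zero] at hk ⊢
  have h3 := abs_lt.1 hk
  rw [abs_lt]
  constructor <;> linarith [h1.1, h1.2, h2.1, h2.2, h3.1, h3.2]

end ConvexConvergence

/-! ### A positive kernel with compactly supported Fourier transform -/

section Kernel

/-- The triangle function. -/
noncomputable def triangle (α : ℝ) : ℝ := max 0 (1 - |α|)

theorem continuous_triangle : Continuous triangle := by unfold triangle; fun_prop

theorem triangle_nonneg (α : ℝ) : 0 ≤ triangle α := le_max_left _ _

theorem triangle_le_one (α : ℝ) : triangle α ≤ 1 :=
  max_le zero_le_one (by linarith [abs_nonneg α])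

theorem triangle_of_one_le {α : ℝ} (h : 1 ≤ |α|) : triangle α = 0 := max_eq_left (by linarith)

theorem integrable_triangle : Integrable triangle := by
  refine continuous_triangle.integrable_of_hasCompactSupport ?_
  refine HasCompactSupport.intro (isCompact_Icc (a := (-1 : ℝ)) (b := 1)) fun x hx => ?_
  refine triangle_of_one_le ?_
  by_contra! h
  exact hx ⟨(abs_lt.1 h).1.le, (abs_lt.1 h).2.le⟩

/-- Explicit antiderivatives on either side of the kink at the origin, followed by the half-angle
formula. They divide by `s`, whence the separate case `s = 0`. -/
theorem integral_triangle_mul_cexp (s : ℝ) :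
    ∫ α : ℝ, (triangle α : ℂ) * Complex.exp (α * s * Complex.I) = ((Real.sinc (s / 2) ^ 2 : ℝ) : ℂ) := by
  have h1 : ∫ α : ℝ, (triangle α : ℂ) * Complex.exp (α * s * Complex.I) =
      ∫ α in (-1 : ℝ)..1, (triangle α : ℂ) * Complex.exp (α * s * Complex.I) := by
    rw [intervalIntegral.integral_of_le (by norm_num), ← integral_Icc_eq_integral_Ioc,
      setIntegral_eq_integral_of_forall_compl_eq_zero]
    intro x hx
    rw [triangle_of_one_le]
    · simp
    · by_contra! h
      exact hx ⟨(abs_lt.1 h).1.le, (abs_lt.1 h).2.le⟩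
  have hc : Continuous fun α : ℝ => (triangle α : ℂ) * Complex.exp (α * s * Complex.I) := by
    have := continuous_triangle
    fun_prop
  rw [h1, ← intervalIntegral.integral_add_adjacent_intervals (b := 0)
    (hc.intervalIntegrable _ _) (hc.intervalIntegrable _ _)]
  have e1 : ∫ α in (-1 : ℝ)..0, (triangle α : ℂ) * Complex.exp (α * s * Complex.I) =
      ∫ α in (-1 : ℝ)..0, (1 + α : ℂ) * Complex.exp (α * s * Complex.I) := by
    refine intervalIntegral.integral_congr fun α hα => ?_
    rw [Set.uIcc_of_le (by norm_num)] at hα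
    have : triangle α = 1 + α := by
      rw [triangle, abs_of_nonpos hα.2, max_eq_right (by linarith [hα.1])]; ring
    simp [this]
  have e2 : ∫ α in (0 : ℝ)..1, (triangle α : ℂ) * Complex.exp (α * s * Complex.I) =
      ∫ α in (0 : ℝ)..1, (1 - α : ℂ) * Complex.exp (α * s * Complex.I) := by
    refine intervalIntegral.integral_congr fun α hα => ?_
    rw [Set.uIcc_of_le (by norm_num)] at hα
    have : triangle α = 1 - α := by
      rw [triangle, abs_of_nonneg hα.1, max_eq_right (by linarith [hα.2])]
    simp [this]
  rw [e1, e2]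
  by_cases hs : s = 0
  · subst hs
    have i1 : ∫ α in (-1 : ℝ)..0, (1 + α : ℂ) = ((∫ α in (-1 : ℝ)..0, (1 + α : ℝ) : ℝ) : ℂ) := by
      rw [← intervalIntegral.integral_ofReal]; simp
    have i2 : ∫ α in (0 : ℝ)..1, (1 - α : ℂ) = ((∫ α in (0 : ℝ)..1, (1 - α : ℝ) : ℝ) : ℂ) := by
      rw [← intervalIntegral.integral_ofReal]; simp
    simp only [Complex.ofReal_zero, mul_zero, zero_mul, Complex.exp_zero, mul_one]
    rw [i1, i2, intervalIntegral.integral_add (by simp) (by simp),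
      intervalIntegral.integral_sub (by simp) (by simp)]
    simp
    norm_num
  · have hs' : (s : ℂ) ≠ 0 := by exact_mod_cast hs
    have hsI : (s * Complex.I : ℂ) ≠ 0 := by simp [hs]
    have hd : ∀ α : ℝ, HasDerivAt (fun α : ℝ => Complex.exp (α * s * Complex.I))
        (Complex.exp (α * s * Complex.I) * (s * Complex.I)) α := by
      intro α
      have := ((Complex.ofRealCLM.hasDerivAt (x := α)).mul_const (s * Complex.I)).cexp
      simpa [mul_assoc] using this
    have ho : ∀ α : ℝ, HasDerivAt (fun α : ℝ => (α : ℂ)) 1 α := fun α => by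
      simpa using (hasDerivAt_id α).ofReal_comp
    have j1 : ∫ α in (-1 : ℝ)..0, (1 + α : ℂ) * Complex.exp (α * s * Complex.I) =
        1 / (s * Complex.I) - 1 / (s * Complex.I) ^ 2 +
          Complex.exp (-(s * Complex.I)) / (s * Complex.I) ^ 2 := by
      rw [intervalIntegral.integral_eq_sub_of_hasDerivAt
        (f := fun α : ℝ => (1 + α : ℂ) * Complex.exp (α * s * Complex.I) / (s * Complex.I) -
          Complex.exp (α * s * Complex.I) / (s * Complex.I) ^ 2)]
      · simp
        try ring
      · intro α _
        refine HasDerivAt.congr_deriv (((((ho α).const_add 1).mul (hd α)).div_const (s * Complex.I)).sub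
          ((hd α).div_const ((s * Complex.I) ^ 2))) ?_
        field_simp
        ring
      · exact Continuous.intervalIntegrable (by fun_prop) _ _
    have j2 : ∫ α in (0 : ℝ)..1, (1 - α : ℂ) * Complex.exp (α * s * Complex.I) =
        Complex.exp (s * Complex.I) / (s * Complex.I) ^ 2 - 1 / (s * Complex.I)
          - 1 / (s * Complex.I) ^ 2 := by
      rw [intervalIntegral.integral_eq_sub_of_hasDerivAt
        (f := fun α : ℝ => (1 - α : ℂ) * Complex.exp (α * s * Complex.I) / (s * Complex.I) +
          Complex.exp (α * s * Complex.I) / (s * Complex.I) ^ 2)]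
      · simp
        try ring
      · intro α _
        refine HasDerivAt.congr_deriv (((((ho α).const_sub 1).mul (hd α)).div_const (s * Complex.I)).add
          ((hd α).div_const ((s * Complex.I) ^ 2))) ?_
        field_simp
        ring
      · exact Continuous.intervalIntegrable (by fun_prop) _ _
    rw [j1, j2, Real.sinc_of_ne_zero (by simpa using hs)]
    have hcos : Real.sin (s / 2) ^ 2 = (1 - Real.cos s) / 2 := by
      rw [Real.sin_sq_eq_half_sub]; ring_nf
    rw [div_pow, hcos]
    have hexp : Complex.exp (s * Complex.I) + Complex.exp (-(s * Complex.I)) =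
        2 * (Real.cos s : ℂ) := by
      rw [Complex.ofReal_cos, Complex.cos]; ring_nf
    push_cast
    rw [mul_pow, Complex.I_sq]
    push_cast at hexp
    field_simp
    linear_combination (-Complex.I) * hexp

/-- A continuous function supported in `[-1, 1]` whose Fourier transform is positive. -/
noncomputable def kernelHat (α : ℝ) : ℂ := triangle α * (1 + Complex.exp (α * Real.pi * Complex.I))

/-- A continuous positive function with quadratic decay and compactly supported Fourier
transform. -/
noncomputable def kernel (s : ℝ) : ℝ := Real.sinc (s / 2) ^ 2 + Real.sinc ((s + Real.pi) / 2) ^ 2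

theorem continuous_kernelHat : Continuous kernelHat := by
  have := continuous_triangle
  unfold kernelHat; fun_prop

theorem kernelHat_zero : kernelHat 0 = 2 := by
  simp [kernelHat, triangle]; norm_num

theorem kernelHat_of_one_le {α : ℝ} (h : 1 ≤ |α|) : kernelHat α = 0 := by
  simp [kernelHat, triangle_of_one_le h]

theorem norm_kernelHat_le (α : ℝ) : ‖kernelHat α‖ ≤ 2 * triangle α := by
  rw [kernelHat, norm_mul, Complex.norm_real, Real.norm_of_nonneg (triangle_nonneg α), mul_comm]
  refine mul_le_mul_of_nonneg_right ?_ (triangle_nonneg α)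
  refine (norm_add_le _ _).trans ?_
  rw [norm_one, ← Complex.ofReal_mul, Complex.norm_exp_ofReal_mul_I]
  norm_num

theorem integrable_kernelHat : Integrable kernelHat :=
  (integrable_triangle.const_mul 2).mono' continuous_kernelHat.aestronglyMeasurable
    (Eventually.of_forall norm_kernelHat_le)

theorem norm_kernelHat_le_two (α : ℝ) : ‖kernelHat α‖ ≤ 2 :=
  (norm_kernelHat_le α).trans (by linarith [triangle_le_one α])

theorem continuous_kernel : Continuous kernel := by
  have := Real.continuous_sinc
  unfold kernel; fun_prop

theorem kernel_nonneg (s : ℝ) : 0 ≤ kernel s := by unfold kernel; positivity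

theorem kernel_le_two (s : ℝ) : kernel s ≤ 2 := by
  have h : ∀ x, Real.sinc x ^ 2 ≤ 1 := fun x => by
    rw [sq_le_one_iff_abs_le_one]; exact Real.abs_sinc_le_one x
  unfold kernel
  linarith [h (s / 2), h ((s + Real.pi) / 2)]

/-- Modulating the triangle by `exp (iαπ)` translates its transform by `π`, which produces the
second squared sinc of `kernel`. -/
theorem integral_kernelHat_mul_cexp (s : ℝ) :
    ∫ α : ℝ, kernelHat α * Complex.exp (α * s * Complex.I) = kernel s := by
  have hi : ∀ u : ℝ, Integrable fun α : ℝ => (triangle α : ℂ) * Complex.exp (α * u * Complex.I) := by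
    intro u
    refine integrable_triangle.mono' ?_ (Eventually.of_forall fun α => ?_)
    · have := continuous_triangle
      exact Continuous.aestronglyMeasurable (by fun_prop)
    · rw [norm_mul, ← Complex.ofReal_mul, Complex.norm_exp_ofReal_mul_I, mul_one, Complex.norm_real,
        Real.norm_of_nonneg (triangle_nonneg α)]
  have : ∀ α : ℝ, kernelHat α * Complex.exp (α * s * Complex.I) =
      (triangle α : ℂ) * Complex.exp (α * s * Complex.I) +
      (triangle α : ℂ) * Complex.exp (α * (s + Real.pi : ℝ) * Complex.I) := by
    intro α
    rw [kernelHat, Complex.ofReal_add, mul_add (α : ℂ), add_mul _ _ Complex.I, Complex.exp_add]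
    ring
  simp_rw [this]
  rw [integral_add (hi s) (hi _), integral_triangle_mul_cexp, integral_triangle_mul_cexp, kernel]
  push_cast
  rfl

/-- The translation by `π` turns the sine of the second sinc into a cosine, so `sin² + cos² = 1`
leaves a quadratically decaying floor. A single squared sinc has zeros and could not be divided by.
-/
theorem four_div_sq_le_kernel {s : ℝ} (hs : 0 ≤ s) : 4 / (s + Real.pi) ^ 2 ≤ kernel s := by
  have hpi := Real.pi_pos
  have h2 : Real.sinc ((s + Real.pi) / 2) ^ 2 = 4 * Real.cos (s / 2) ^ 2 / (s + Real.pi) ^ 2 := by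
    rw [Real.sinc_of_ne_zero (by positivity), add_div, Real.sin_add_pi_div_two]
    field_simp
    ring
  have h1 : 4 * Real.sin (s / 2) ^ 2 / (s + Real.pi) ^ 2 ≤ Real.sinc (s / 2) ^ 2 := by
    rcases hs.eq_or_lt with rfl | hs
    · simp
    · rw [Real.sinc_of_ne_zero (by positivity), div_pow, div_pow, div_div_eq_mul_div, mul_comm,
        show ((2 : ℝ) ^ 2) = 4 by norm_num]
      gcongr
      linarith
  rw [kernel, h2]
  calc 4 / (s + Real.pi) ^ 2 = 4 * Real.sin (s / 2) ^ 2 / (s + Real.pi) ^ 2 +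
        4 * Real.cos (s / 2) ^ 2 / (s + Real.pi) ^ 2 := by
        rw [← add_div, ← mul_add, Real.sin_sq_add_cos_sq, mul_one]
    _ ≤ _ := by gcongr

/-- The two sincs can vanish only where `sin (s / 2)` and `cos (s / 2)` do, which never happens
together. -/
theorem kernel_pos (s : ℝ) : 0 < kernel s := by
  refine (kernel_nonneg s).lt_of_ne fun h => ?_
  rw [kernel, eq_comm, add_eq_zero_iff_of_nonneg (by positivity) (by positivity)] at h
  have h1 := pow_eq_zero_iff two_ne_zero |>.1 h.1
  have h2 := pow_eq_zero_iff two_ne_zero |>.1 h.2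
  have hs : s / 2 ≠ 0 := fun h0 => by simp [h0] at h1
  have hs' : (s + Real.pi) / 2 ≠ 0 := fun h0 => by simp [h0] at h2
  rw [Real.sinc_of_ne_zero hs, div_eq_zero_iff, or_iff_left hs] at h1
  rw [Real.sinc_of_ne_zero hs', div_eq_zero_iff, or_iff_left hs', add_div,
    Real.sin_add_pi_div_two] at h2
  have := Real.sin_sq_add_cos_sq (s / 2)
  rw [h1, h2] at this
  norm_num at this

theorem integrable_kernel : Integrable kernel := by
  have hb : Integrable fun x : ℝ => Real.sinc x ^ 2 := by
    refine (integrable_inv_one_add_sq.const_mul 2).mono'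
      (Real.continuous_sinc.pow 2).aestronglyMeasurable (Eventually.of_forall fun x => ?_)
    rw [Real.norm_of_nonneg (by positivity), ← div_eq_mul_inv, le_div_iff₀ (by positivity)]
    have h1 : Real.sinc x ^ 2 ≤ 1 := by
      rw [sq_le_one_iff_abs_le_one]; exact Real.abs_sinc_le_one x
    have h2 : Real.sinc x ^ 2 * x ^ 2 ≤ 1 := by
      by_cases hx : x = 0
      · simp [hx]
      · rw [Real.sinc_of_ne_zero hx, div_pow, div_mul_cancel₀ _ (by positivity)]
        exact Real.sin_sq_le_one x
    linarith
  unfold kernel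
  refine (hb.comp_div two_ne_zero).add ?_
  exact (hb.comp_div two_ne_zero).comp_add_right Real.pi

/-- Fourier inversion, with `2π` from the normalization of the transform. At `a = 0` it gives the
total mass `4π` that normalizes `limitDensity`. -/
theorem integral_kernel_mul_cexp (a : ℝ) :
    ∫ s : ℝ, (kernel s : ℂ) * Complex.exp (a * s * Complex.I) =
      2 * Real.pi * kernelHat (-a) := by
  have hF : FourierTransform.fourier kernelHat = fun w : ℝ => (kernel (-(2 * Real.pi * w)) : ℂ) := by
    ext w
    rw [Real.fourier_eq', ← integral_kernelHat_mul_cexp]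
    refine integral_congr_ae (Eventually.of_forall fun v => ?_)
    simp only [RCLike.inner_apply, conj_trivial, smul_eq_mul]
    rw [mul_comm]
    push_cast
    ring_nf
  have hk : Integrable fun s : ℝ => (kernel s : ℂ) := integrable_kernel.ofReal
  have hFi : Integrable (FourierTransform.fourier kernelHat) := by
    rw [hF]
    exact (hk.comp_neg.comp_mul_left' (g := fun s => (kernel (-s) : ℂ))
      (R := 2 * Real.pi) (by positivity))
  have hinv := congrFun (continuous_kernelHat.fourierInv_fourier_eq integrable_kernelHat hFi) (-a)
  rw [Real.fourierInv_eq', hF] at hinv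
  have hsub := Measure.integral_comp_mul_left
    (fun s : ℝ => (kernel s : ℂ) * Complex.exp (a * s * Complex.I)) (-(2 * Real.pi))
  rw [← hinv]
  have : ∀ v : ℝ, Complex.exp ((2 * Real.pi * inner ℝ v (-a) : ℝ) * Complex.I) •
      (kernel (-(2 * Real.pi * v)) : ℂ) = (kernel (-(2 * Real.pi) * v) : ℂ) *
      Complex.exp (a * (-(2 * Real.pi) * v : ℝ) * Complex.I) := by
    intro v
    simp only [RCLike.inner_apply, conj_trivial, smul_eq_mul]
    rw [mul_comm, neg_mul]
    push_cast
    ring_nf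
  simp_rw [this]
  rw [hsub, abs_inv, abs_neg, abs_of_pos (by positivity), Complex.real_smul]
  have hpi : (Real.pi : ℂ) ≠ 0 := by exact_mod_cast Real.pi_ne_zero
  push_cast
  field_simp
  exact integral_congr_ae (Eventually.of_forall fun v => by ring_nf)

end Kernel

/-! ### Joint local and central limit theorem over convex sets -/

section LocalLimit

/-- The function `s ↦ exp (-s) / kernel s` on the half-line, extended by a constant. -/
noncomputable def expDivKernel (s : ℝ) : ℝ := Real.exp (-max s 0) / kernel (max s 0)

theorem continuous_expDivKernel : Continuous expDivKernel := by
  have := continuous_kernel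
  unfold expDivKernel
  exact Continuous.div (by fun_prop) (by fun_prop) fun s => (kernel_pos _).ne'

theorem expDivKernel_nonneg (s : ℝ) : 0 ≤ expDivKernel s :=
  div_nonneg (Real.exp_pos _).le (kernel_nonneg _)

/-- The exponential beats the quadratic floor of the kernel. The constant works because `(u + π)² ≤
2u² + 2π² ≤ 40 (1 + u + u²/2) ≤ 40 exp u`. -/
theorem expDivKernel_le (s : ℝ) : expDivKernel s ≤ 10 := by
  unfold expDivKernel
  have hs : 0 ≤ max s 0 := le_max_right _ _
  generalize max s 0 = u at hs
  have hpi := Real.pi_pos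
  have hpi' : Real.pi < 3.15 := Real.pi_lt_d2
  rw [div_le_iff₀ (kernel_pos _)]
  have h1 := four_div_sq_le_kernel hs
  have h2 := Real.quadratic_le_exp_of_nonneg hs
  have h3 : Real.exp (-u) ≤ 10 * (4 / (u + Real.pi) ^ 2) := by
    rw [Real.exp_neg, mul_div_assoc', inv_eq_one_div, div_le_div_iff₀ (Real.exp_pos _) (by positivity)]
    nlinarith [sq_nonneg (u - Real.pi)]
  linarith

theorem kernel_mul_expDivKernel {s : ℝ} (hs : 0 ≤ s) :
    kernel s * expDivKernel s = Real.exp (-s) := by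
  rw [expDivKernel, max_eq_left hs, mul_div_cancel₀ _ (kernel_pos _).ne']

variable {F : Type*} [NormedAddCommGroup F] [InnerProductSpace ℝ F] [FiniteDimensional ℝ F]
  [MeasurableSpace F] [BorelSpace F]

/-- The measure with density `p` with respect to `ν`, carried to the Hilbert space product. -/
noncomputable def densityMeasure (ν : Measure (ℝ × F)) (p : ℝ × F → ℝ) :
    Measure (WithLp 2 (ℝ × F)) :=
  (ν.withDensity fun x => ENNReal.ofReal (p x)).map (MeasurableEquiv.toLp 2 (ℝ × F))

theorem integral_densityMeasure {E : Type*} [NormedAddCommGroup E] [NormedSpace ℝ E]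
    {ν : Measure (ℝ × F)} {p : ℝ × F → ℝ} (hp : Measurable p) (hp0 : ∀ x, 0 ≤ p x)
    (g : WithLp 2 (ℝ × F) → E) :
    ∫ y, g y ∂(densityMeasure ν p) = ∫ x, p x • g (WithLp.toLp 2 x) ∂ν := by
  rw [densityMeasure, integral_map_equiv, integral_withDensity_eq_integral_toReal_smul
    hp.ennreal_ofReal (Eventually.of_forall fun x => ENNReal.ofReal_lt_top)]
  simp [ENNReal.toReal_ofReal (hp0 _)]

theorem setIntegral_densityMeasure {E : Type*} [NormedAddCommGroup E] [NormedSpace ℝ E]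
    {ν : Measure (ℝ × F)} {p : ℝ × F → ℝ} (hp : Measurable p) (hp0 : ∀ x, 0 ≤ p x)
    (g : WithLp 2 (ℝ × F) → E) {B : Set (ℝ × F)} (hB : MeasurableSet B) :
    ∫ y in (WithLp.ofLp ⁻¹' B), g y ∂(densityMeasure ν p) =
      ∫ x in B, p x • g (WithLp.toLp 2 x) ∂ν := by
  have hm : MeasurableSet (WithLp.ofLp ⁻¹' B : Set (WithLp 2 (ℝ × F))) :=
    (WithLp.measurable_ofLp 2 (ℝ × F)) hB
  rw [← integral_indicator hm, integral_densityMeasure hp hp0, ← integral_indicator hB]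
  refine integral_congr_ae (Eventually.of_forall fun x => ?_)
  by_cases hx : x ∈ B <;> simp [hx]

theorem isProbabilityMeasure_densityMeasure {ν : Measure (ℝ × F)} {p : ℝ × F → ℝ}
    (hp0 : ∀ x, 0 ≤ p x) (hi : Integrable p ν) (h1 : ∫ x, p x ∂ν = 1) :
    IsProbabilityMeasure (densityMeasure ν p) := by
  have : IsProbabilityMeasure (ν.withDensity fun x => ENNReal.ofReal (p x)) := by
    constructor
    rw [withDensity_apply _ MeasurableSet.univ, Measure.restrict_univ,
      ← ofReal_integral_eq_lintegral_ofReal hi (Eventually.of_forall hp0), h1, ENNReal.ofReal_one]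
  exact Measure.isProbabilityMeasure_map (MeasurableEquiv.measurable _).aemeasurable

/-- The joint characteristic function of a measure on `ℝ × F`. -/
noncomputable def jointCharFun (ν : Measure (ℝ × F)) (α : ℝ) (β : F) : ℂ :=
  ∫ x, Complex.exp (((α * x.1 + inner ℝ x.2 β : ℝ) : ℂ) * Complex.I) ∂ν

theorem continuous_jointCharFun (ν : Measure (ℝ × F)) [IsProbabilityMeasure ν] (β : F) :
    Continuous fun α => jointCharFun ν α β := by
  unfold jointCharFun
  refine continuous_of_dominated (bound := fun _ => 1) (fun α => ?_)
    (fun α => Eventually.of_forall fun x => ?_) (integrable_const _)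
    (Eventually.of_forall fun x => by fun_prop)
  · exact Continuous.aestronglyMeasurable (by fun_prop)
  · rw [Complex.norm_exp_ofReal_mul_I]

theorem charFun_densityMeasure {ν : Measure (ℝ × F)} {p : ℝ × F → ℝ} (hp : Measurable p)
    (hp0 : ∀ x, 0 ≤ p x) (z : WithLp 2 (ℝ × F)) :
    charFun (densityMeasure ν p) z = ∫ x, (p x : ℂ) *
      Complex.exp (((z.ofLp.1 * x.1 + inner ℝ x.2 z.ofLp.2 : ℝ) : ℂ) * Complex.I) ∂ν := by
  rw [charFun_apply, integral_densityMeasure hp hp0]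
  refine integral_congr_ae (Eventually.of_forall fun x => ?_)
  simp only [Complex.real_smul]
  rw [WithLp.prod_inner_apply]
  simp

/-- Multiplication by the kernel amounts to a convolution of the characteristic function. -/
theorem integral_kernel_mul_cexp_eq {ν : Measure (ℝ × F)} [IsProbabilityMeasure ν] (α₀ : ℝ)
    (β : F) :
    ∫ x, (kernel x.1 : ℂ) *
      Complex.exp (((α₀ * x.1 + inner ℝ x.2 β : ℝ) : ℂ) * Complex.I) ∂ν =
      ∫ α : ℝ, kernelHat α * jointCharFun ν (α + α₀) β := by
  have h1 : ∀ x : ℝ × F, (kernel x.1 : ℂ) *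
      Complex.exp (((α₀ * x.1 + inner ℝ x.2 β : ℝ) : ℂ) * Complex.I) =
      ∫ α : ℝ, kernelHat α *
        Complex.exp ((((α + α₀) * x.1 + inner ℝ x.2 β : ℝ) : ℂ) * Complex.I) := by
    intro x
    rw [← integral_kernelHat_mul_cexp, ← integral_mul_const]
    refine integral_congr_ae (Eventually.of_forall fun α => ?_)
    simp only
    rw [mul_assoc, ← Complex.exp_add]
    push_cast
    ring_nf
  simp_rw [h1]
  rw [integral_integral_swap]
  · refine integral_congr_ae (Eventually.of_forall fun α => ?_)
    simp only
    rw [integral_const_mul, jointCharFun]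
  · have hi : Integrable (fun q : (ℝ × F) × ℝ => kernelHat q.2) (ν.prod volume) := by
      simpa using (integrable_const (μ := ν) (1 : ℂ)).mul_prod integrable_kernelHat
    have := continuous_kernelHat
    refine hi.norm.mono' ?_ (Eventually.of_forall fun q => ?_)
    · exact Continuous.aestronglyMeasurable (by unfold Function.uncurry; fun_prop)
    · simp only [Function.uncurry]
      rw [norm_mul, Complex.norm_exp_ofReal_mul_I, mul_one]

/-- The local limit of the convolved characteristic functions. -/
theorem tendsto_mul_integral_kernelHat {ν : ℕ → Measure (ℝ × F)}
    [∀ k, IsProbabilityMeasure (ν k)] {σ : ℕ → ℝ} (hσ : Tendsto σ atTop atTop)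
    {ρ : ℕ → ℝ → F → ℂ}
    (hchar : ∀ k α β, jointCharFun (ν k) α β =
      Complex.exp (-(((σ k * α) ^ 2 + ‖β‖ ^ 2 : ℝ) : ℂ) / 2) * ρ k α β)
    (hbdd : ∀ R : ℝ, ∃ b : ℝ, ∀ᶠ k in atTop, ∀ α (β : F), |α| ≤ R → ‖β‖ ≤ R → ‖ρ k α β‖ ≤ b)
    (hlim : ∀ (β : F) (α : ℕ → ℝ), Tendsto α atTop (𝓝 0) →
      Tendsto (fun k => ρ k (α k) β) atTop (𝓝 1)) (α₀ : ℝ) (β : F) :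
    Tendsto (fun k => (σ k : ℂ) * ∫ α : ℝ, kernelHat α * jointCharFun (ν k) (α + α₀) β) atTop
      (𝓝 (kernelHat (-α₀) * Real.sqrt (2 * Real.pi) * Complex.exp (-((‖β‖ ^ 2 : ℝ) : ℂ) / 2))) := by
  -- Continuity of `ρ` is not assumed: it follows on dividing the characteristic function by the
  -- nonvanishing Gaussian.
  have hρc : ∀ k, Continuous fun α => ρ k α β := by
    intro k
    have : (fun α => ρ k α β) = fun α => Complex.exp ((((σ k * α) ^ 2 + ‖β‖ ^ 2 : ℝ) : ℂ) / 2) *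
        jointCharFun (ν k) α β := by
      ext α
      rw [hchar, ← mul_assoc, ← Complex.exp_add, neg_div, add_neg_cancel, Complex.exp_zero, one_mul]
    rw [this]
    have := continuous_jointCharFun (ν k) β
    fun_prop
  -- The substitution `a = σ k * α` absorbs the prefactor `σ k` and makes the Gaussian independent
  -- of `k`.
  set g : ℕ → ℝ → ℂ := fun k a => kernelHat (a / σ k - α₀) *
    (Complex.exp (-((a ^ 2 + ‖β‖ ^ 2 : ℝ) : ℂ) / 2) * ρ k (a / σ k) β) with hg
  have hkey : ∀ᶠ k in atTop, ∫ a, g k a =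
      (σ k : ℂ) * ∫ α : ℝ, kernelHat α * jointCharFun (ν k) (α + α₀) β := by
    filter_upwards [hσ.eventually_gt_atTop 0] with k hk
    have h1 : ∫ α : ℝ, kernelHat α * jointCharFun (ν k) (α + α₀) β =
        ∫ α : ℝ, kernelHat (α - α₀) * jointCharFun (ν k) α β := by
      rw [← integral_sub_right_eq_self _ α₀]
      simp
    have h2 := Measure.integral_comp_div
      (fun α : ℝ => kernelHat (α - α₀) * jointCharFun (ν k) α β) (σ k)
    rw [h1, abs_of_pos hk, Complex.real_smul] at *
    rw [← h2]
    refine integral_congr_ae (Eventually.of_forall fun a => ?_)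
    simp only [hg]
    rw [hchar, mul_div_cancel₀ _ hk.ne']
  refine Tendsto.congr' hkey ?_
  -- On the support of the shifted `kernelHat` the frequency `a / σ k` is at most `1 + |α₀|` in
  -- absolute value, so a bound for `ρ` on bounded sets gives domination.
  obtain ⟨b, hb⟩ := hbdd (max (1 + |α₀|) ‖β‖)
  have hgl : ∫ a : ℝ, kernelHat (-α₀) * Complex.exp (-((a ^ 2 + ‖β‖ ^ 2 : ℝ) : ℂ) / 2) =
      kernelHat (-α₀) * Real.sqrt (2 * Real.pi) * Complex.exp (-((‖β‖ ^ 2 : ℝ) : ℂ) / 2) := by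
    have : ∀ a : ℝ, kernelHat (-α₀) * Complex.exp (-((a ^ 2 + ‖β‖ ^ 2 : ℝ) : ℂ) / 2) =
        kernelHat (-α₀) * ((Real.exp (-(1 / 2) * a ^ 2) : ℝ) : ℂ) *
          Complex.exp (-((‖β‖ ^ 2 : ℝ) : ℂ) / 2) := by
      intro a
      rw [mul_assoc, Complex.ofReal_exp, ← Complex.exp_add]
      congr 2
      push_cast
      ring
    simp_rw [this]
    rw [integral_mul_const, integral_const_mul, integral_complex_ofReal, integral_gaussian]
    congr 4
    ring
  rw [← hgl]
  refine tendsto_integral_filter_of_dominated_convergence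
    (fun a => 2 * b * Real.exp (-(1 / 2) * a ^ 2)) ?_ ?_ ?_ ?_
  · refine Eventually.of_forall fun k => Continuous.aestronglyMeasurable ?_
    have := hρc k
    have := continuous_kernelHat
    simp only [hg]
    fun_prop
  · filter_upwards [hb] with k hk
    refine Eventually.of_forall fun a => ?_
    have hb0 : 0 ≤ b := (norm_nonneg _).trans
      (hk 0 β (by simp) (le_max_right _ _))
    simp only [hg]
    by_cases hsupp : 1 ≤ |a / σ k - α₀|
    · rw [kernelHat_of_one_le hsupp, zero_mul, norm_zero]
      positivity
    · push Not at hsupp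
      rw [norm_mul, norm_mul, mul_assoc]
      refine mul_le_mul (norm_kernelHat_le_two _) ?_ (by positivity) zero_le_two
      rw [mul_comm b]
      refine mul_le_mul ?_ (hk _ β ?_ (le_max_right _ _)) (norm_nonneg _) (Real.exp_pos _).le
      · rw [← Complex.ofReal_neg, Complex.norm_exp]
        refine Real.exp_le_exp.2 ?_
        have : ((-(a ^ 2 + ‖β‖ ^ 2) : ℝ) : ℂ) / 2 = ((-(a ^ 2 + ‖β‖ ^ 2) / 2 : ℝ) : ℂ) := by
          push_cast; ring
        rw [this, Complex.ofReal_re]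
        nlinarith [sq_nonneg ‖β‖]
      · refine le_max_of_le_left ?_
        have : |a / σ k| ≤ |a / σ k - α₀| + |α₀| := by
          simpa using abs_add_le (a / σ k - α₀) α₀
        linarith
  · exact (integrable_exp_neg_mul_sq (by norm_num)).const_mul _
  · refine Eventually.of_forall fun a => ?_
    have hak : Tendsto (fun k => a / σ k) atTop (𝓝 0) := hσ.const_div_atTop a
    have h1 : Tendsto (fun k => kernelHat (a / σ k - α₀)) atTop (𝓝 (kernelHat (-α₀))) := by
      have := (continuous_kernelHat.tendsto (0 - α₀)).comp (hak.sub_const α₀)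
      rwa [zero_sub] at this
    have h2 := (hlim β _ hak).const_mul (Complex.exp (-((a ^ 2 + ‖β‖ ^ 2 : ℝ) : ℂ) / 2))
    rw [mul_one] at h2
    exact h1.mul h2

/-- The density of the limiting law: the normalized kernel times the Gaussian density. -/
noncomputable def limitDensity (x : ℝ × F) : ℝ :=
  (4 * Real.pi)⁻¹ * kernel x.1 *
    ((2 * Real.pi) ^ (-(Module.finrank ℝ F : ℝ) / 2) * Real.exp (-(1 / 2) * ‖x.2‖ ^ 2))

theorem continuous_limitDensity : Continuous (limitDensity (F := F)) := by
  have := continuous_kernel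
  unfold limitDensity; fun_prop

theorem limitDensity_nonneg (x : ℝ × F) : 0 ≤ limitDensity x := by
  have := kernel_nonneg x.1
  have := Real.pi_pos
  unfold limitDensity
  positivity

theorem integrable_exp_neg_mul_norm_sq {b : ℝ} (hb : 0 < b) :
    Integrable fun w : F => Real.exp (-b * ‖w‖ ^ 2) := by
  have h := (GaussianFourier.integrable_cexp_neg_mul_sq_norm_add (V := F) (b := b)
    (by simpa using hb) 0 0).norm
  refine h.congr (Eventually.of_forall fun w => ?_)
  simp only
  rw [Complex.norm_exp]
  congr 1
  have : (-b * (‖w‖ : ℂ) ^ 2 + 0 * ((inner ℝ (0 : F) w : ℝ) : ℂ)) =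
      ((-b * ‖w‖ ^ 2 : ℝ) : ℂ) := by push_cast; ring
  rw [this, Complex.ofReal_re]

theorem integrable_exp_neg_half_mul_norm_sq :
    Integrable fun w : F => Real.exp (-(1 / 2) * ‖w‖ ^ 2) :=
  integrable_exp_neg_mul_norm_sq (by norm_num)

theorem integrable_limitDensity : Integrable (limitDensity (F := F)) :=
  (integrable_kernel.const_mul _).mul_prod (integrable_exp_neg_half_mul_norm_sq.const_mul _)

/-- The density is a product, so Fourier inversion handles the first factor and the Gaussian
integral the second. The result is the limit in `tendsto_mul_integral_kernelHat` divided by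
`2√(2π)`, its value at zero frequency. -/
theorem integral_limitDensity_mul_cexp (α₀ : ℝ) (β : F) :
    ∫ x, (limitDensity x : ℂ) *
      Complex.exp (((α₀ * x.1 + inner ℝ x.2 β : ℝ) : ℂ) * Complex.I) =
      kernelHat (-α₀) / 2 * Complex.exp (-((‖β‖ ^ 2 : ℝ) : ℂ) / 2) := by
  have hpi : (Real.pi : ℂ) ≠ 0 := by exact_mod_cast Real.pi_ne_zero
  have hsplit : ∀ x : ℝ × F, (limitDensity x : ℂ) *
      Complex.exp (((α₀ * x.1 + inner ℝ x.2 β : ℝ) : ℂ) * Complex.I) =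
      ((4 * Real.pi : ℂ)⁻¹ * ((kernel x.1 : ℂ) * Complex.exp (α₀ * x.1 * Complex.I))) *
      ((((2 * Real.pi) ^ (-(Module.finrank ℝ F : ℝ) / 2) : ℝ) : ℂ) *
        Complex.exp (-(1 / 2) * ‖x.2‖ ^ 2 + Complex.I * (inner ℝ β x.2 : ℝ))) := by
    intro x
    rw [limitDensity, real_inner_comm, Complex.exp_add, Complex.ofReal_add, add_mul,
      Complex.exp_add]
    push_cast
    ring_nf
  simp_rw [hsplit]
  rw [Measure.volume_eq_prod, integral_prod_mul
    (f := fun s : ℝ => (4 * Real.pi : ℂ)⁻¹ * ((kernel s : ℂ) * Complex.exp (α₀ * s * Complex.I)))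
    (g := fun w : F => (((2 * Real.pi) ^ (-(Module.finrank ℝ F : ℝ) / 2) : ℝ) : ℂ) *
        Complex.exp (-(1 / 2) * ‖w‖ ^ 2 + Complex.I * (inner ℝ β w : ℝ))),
    integral_const_mul, integral_const_mul, integral_kernel_mul_cexp,
    GaussianFourier.integral_cexp_neg_mul_sq_norm_add (by norm_num)]
  have hpow : (((2 * Real.pi) ^ (-(Module.finrank ℝ F : ℝ) / 2) : ℝ) : ℂ) *
      (Real.pi / (1 / 2) : ℂ) ^ ((Module.finrank ℝ F : ℂ) / 2) = 1 := by
    have h0 : (Real.pi / (1 / 2) : ℂ) = ((2 * Real.pi : ℝ) : ℂ) := by push_cast; ring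
    have h1 : ((Module.finrank ℝ F : ℂ) / 2) = (((Module.finrank ℝ F : ℝ) / 2 : ℝ) : ℂ) := by
      push_cast; ring
    have h2 : (0 : ℝ) < 2 * Real.pi := by positivity
    rw [h0, h1, ← Complex.ofReal_cpow h2.le, ← Complex.ofReal_mul, ← Real.rpow_add h2, neg_div,
      neg_add_cancel, Real.rpow_zero, Complex.ofReal_one]
  have hexp : Complex.exp (Complex.I ^ 2 * (‖β‖ : ℂ) ^ 2 / (4 * (1 / 2))) =
      Complex.exp (-((‖β‖ ^ 2 : ℝ) : ℂ) / 2) := by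
    congr 1
    rw [Complex.I_sq]
    push_cast
    ring
  rw [← mul_assoc (((2 * Real.pi) ^ (-(Module.finrank ℝ F : ℝ) / 2) : ℝ) : ℂ), hpow, one_mul, hexp]
  congr 1
  field_simp
  ring

theorem integral_limitDensity : ∫ x : ℝ × F, limitDensity x = 1 := by
  have h := integral_limitDensity_mul_cexp (F := F) 0 0
  simp only [zero_mul, inner_zero_right, add_zero, Complex.ofReal_zero, Complex.exp_zero, mul_one,
    neg_zero, kernelHat_zero, norm_zero] at h
  rw [integral_complex_ofReal] at h
  apply Complex.ofReal_injective
  rw [h]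
  simp

/-- Local limit theorem in the first variable and central limit theorem in the second one, uniform
over convex sets. -/
theorem tendsto_mul_setIntegral_exp_neg_sub {ν : ℕ → Measure (ℝ × F)}
    [∀ k, IsProbabilityMeasure (ν k)] {σ : ℕ → ℝ} (hσ : Tendsto σ atTop atTop)
    {ρ : ℕ → ℝ → F → ℂ}
    (hchar : ∀ k α β, jointCharFun (ν k) α β =
      Complex.exp (-(((σ k * α) ^ 2 + ‖β‖ ^ 2 : ℝ) : ℂ) / 2) * ρ k α β)
    (hbdd : ∀ R : ℝ, ∃ b : ℝ, ∀ᶠ k in atTop, ∀ α (β : F), |α| ≤ R → ‖β‖ ≤ R → ‖ρ k α β‖ ≤ b)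
    (hlim : ∀ (β : F) (α : ℕ → ℝ), Tendsto α atTop (𝓝 0) →
      Tendsto (fun k => ρ k (α k) β) atTop (𝓝 1))
    {B : ℕ → Set (ℝ × F)} (hB : ∀ k, Convex ℝ (B k)) (hBm : ∀ k, MeasurableSet (B k))
    (hB0 : ∀ k, ∀ x ∈ B k, 0 ≤ x.1) :
    Tendsto (fun k => σ k * ∫ x in B k, Real.exp (-x.1) ∂(ν k) -
      (2 * Real.pi) ^ (-((Module.finrank ℝ F : ℝ) + 1) / 2) *
        ∫ x in B k, Real.exp (-x.1) * Real.exp (-(1 / 2) * ‖x.2‖ ^ 2)) atTop (𝓝 0) := by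
  have hpi := Real.pi_pos
  have hJ := tendsto_mul_integral_kernelHat hσ hchar hbdd hlim
  -- The mass near height zero, of order `2√(2π) / σ k`. Dividing by it turns a local statement into
  -- weak convergence of probability measures.
  set c : ℕ → ℝ := fun k => ∫ x, kernel x.1 ∂(ν k) with hc
  have hki : ∀ k, Integrable (fun x : ℝ × F => kernel x.1) (ν k) := fun k =>
    Integrable.of_bound (continuous_kernel.comp continuous_fst).aestronglyMeasurable 2
      (Eventually.of_forall fun x => by
        rw [Real.norm_of_nonneg (kernel_nonneg _)]; exact kernel_le_two _)
  have hcpos : ∀ k, 0 < c k := by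
    intro k
    rw [hc, integral_pos_iff_support_of_nonneg (fun x => kernel_nonneg _) (hki k)]
    have : Function.support (fun x : ℝ × F => kernel x.1) = Set.univ :=
      Set.eq_univ_of_forall fun x => (kernel_pos _).ne'
    rw [this, measure_univ]
    exact one_pos
  have hcJ : ∀ k, (c k : ℂ) = ∫ α : ℝ, kernelHat α * jointCharFun (ν k) (α + 0) (0 : F) := by
    intro k
    rw [← integral_kernel_mul_cexp_eq]
    simp only [hc]
    rw [← integral_complex_ofReal]
    simp
  have hclim : Tendsto (fun k => σ k * c k) atTop (𝓝 (2 * Real.sqrt (2 * Real.pi))) := by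
    have h := hJ 0 0
    simp_rw [← hcJ] at h
    have h' := (Complex.continuous_re.tendsto _).comp h
    simp only [neg_zero, kernelHat_zero, norm_zero] at h'
    convert h' using 1
    · ext k; simp
    · simp
  set p : ℕ → ℝ × F → ℝ := fun k x => (c k)⁻¹ * kernel x.1 with hp
  have hpm : ∀ k, Measurable (p k) := fun k =>
    ((continuous_kernel.comp continuous_fst).measurable).const_mul _
  have hp0 : ∀ k x, 0 ≤ p k x := fun k x =>
    mul_nonneg (inv_nonneg.2 (hcpos k).le) (kernel_nonneg _)
  have hprob : ∀ k, IsProbabilityMeasure (densityMeasure (ν k) (p k)) := fun k =>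
    isProbabilityMeasure_densityMeasure (hp0 k) ((hki k).const_mul _) (by
      simp only [hp]
      rw [integral_const_mul, inv_mul_cancel₀ (hcpos k).ne'])
  have hprob0 : IsProbabilityMeasure (densityMeasure (volume : Measure (ℝ × F)) limitDensity) :=
    isProbabilityMeasure_densityMeasure limitDensity_nonneg integrable_limitDensity
      integral_limitDensity
  have hac : densityMeasure (volume : Measure (ℝ × F)) limitDensity ≪ volume := by
    have h := (WithLp.volume_preserving_toLp ℝ F).map_eq
    rw [densityMeasure, ← h]
    exact (withDensity_absolutelyContinuous _ _).map (MeasurableEquiv.measurable _)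
  set f : WithLp 2 (ℝ × F) → ℝ := fun y => expDivKernel y.ofLp.1 with hf
  have hfc : Continuous f := continuous_expDivKernel.comp
    (continuous_fst.comp (WithLp.prod_continuous_ofLp 2 ℝ F))
  have hconv : ∀ k, Convex ℝ (WithLp.ofLp ⁻¹' (B k) : Set (WithLp 2 (ℝ × F))) := fun k =>
    (hB k).linear_preimage (WithLp.linearEquiv 2 ℝ (ℝ × F)).toLinearMap
  have hmain := tendsto_setIntegral_convex_sub_of_tendsto_charFun
    (μ := fun k => ⟨densityMeasure (ν k) (p k), hprob k⟩)
    (μ₀ := ⟨densityMeasure (volume : Measure (ℝ × F)) limitDensity, hprob0⟩) (fun z => by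
      simp only [ProbabilityMeasure.coe_mk]
      rw [charFun_densityMeasure continuous_limitDensity.measurable limitDensity_nonneg,
        integral_limitDensity_mul_cexp]
      have h1 : ∀ k, charFun (densityMeasure (ν k) (p k)) z = ((σ k * c k : ℝ) : ℂ)⁻¹ *
          ((σ k : ℂ) * ∫ α : ℝ, kernelHat α * jointCharFun (ν k) (α + z.ofLp.1) z.ofLp.2) ∨
          σ k = 0 := by
        intro k
        by_cases hk : σ k = 0
        · exact Or.inr hk
        left
        rw [charFun_densityMeasure (hpm k) (hp0 k), ← integral_kernel_mul_cexp_eq]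
        simp only [hp]
        push_cast
        simp_rw [mul_assoc]
        rw [integral_const_mul, mul_inv]
        have : (σ k : ℂ) ≠ 0 := by exact_mod_cast hk
        rw [mul_comm (σ k : ℂ)⁻¹, mul_assoc, inv_mul_cancel_left₀ this]
      have h2 : Tendsto (fun k => ((σ k * c k : ℝ) : ℂ)⁻¹) atTop
          (𝓝 ((2 * Real.sqrt (2 * Real.pi) : ℝ) : ℂ)⁻¹) := by
        refine ((Complex.continuous_ofReal.tendsto _).comp hclim).inv₀ ?_
        have : 0 < Real.sqrt (2 * Real.pi) := Real.sqrt_pos.2 (by positivity)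
        exact_mod_cast (by positivity : (2 * Real.sqrt (2 * Real.pi)) ≠ 0)
      have h3 := h2.mul (hJ z.ofLp.1 z.ofLp.2)
      have h4 : ((2 * Real.sqrt (2 * Real.pi) : ℝ) : ℂ)⁻¹ * (kernelHat (-z.ofLp.1) *
          Real.sqrt (2 * Real.pi) * Complex.exp (-((‖z.ofLp.2‖ ^ 2 : ℝ) : ℂ) / 2)) =
          kernelHat (-z.ofLp.1) / 2 * Complex.exp (-((‖z.ofLp.2‖ ^ 2 : ℝ) : ℂ) / 2) := by
        have : (Real.sqrt (2 * Real.pi) : ℂ) ≠ 0 := by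
          exact_mod_cast (Real.sqrt_pos.2 (by positivity : 0 < 2 * Real.pi)).ne'
        rw [Complex.ofReal_mul]
        push_cast
        field_simp
      rw [h4] at h3
      refine h3.congr' ?_
      filter_upwards [hσ.eventually_gt_atTop 0] with k hk
      exact ((h1 k).resolve_right hk.ne').symm) hac hfc (c := 10)
    (fun y => expDivKernel_nonneg _) (fun y => expDivKernel_le _) hconv
    (fun k => (WithLp.measurable_ofLp 2 (ℝ × F)) (hBm k))
  simp only [ProbabilityMeasure.coe_mk] at hmain
  -- Heights in `B k` are nonnegative, so the kernel in the density times `f` is exactly `exp (-s)`;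
  -- the same holds under `ν k` below.
  have hI0 : ∀ k, ∫ y in (WithLp.ofLp ⁻¹' (B k)), f y
      ∂(densityMeasure (volume : Measure (ℝ × F)) limitDensity) =
      (4 * Real.pi)⁻¹ * (2 * Real.pi) ^ (-(Module.finrank ℝ F : ℝ) / 2) *
        ∫ x in B k, Real.exp (-x.1) * Real.exp (-(1 / 2) * ‖x.2‖ ^ 2) := by
    intro k
    rw [setIntegral_densityMeasure continuous_limitDensity.measurable limitDensity_nonneg _ (hBm k),
      ← integral_const_mul]
    refine setIntegral_congr_fun (hBm k) fun x hx => ?_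
    simp only [hf, limitDensity, smul_eq_mul]
    rw [← kernel_mul_expDivKernel (hB0 k x hx)]
    ring
  have hIk : ∀ k, c k * ∫ y in (WithLp.ofLp ⁻¹' (B k)), f y ∂(densityMeasure (ν k) (p k)) =
      ∫ x in B k, Real.exp (-x.1) ∂(ν k) := by
    intro k
    rw [setIntegral_densityMeasure (hpm k) (hp0 k) _ (hBm k), ← integral_const_mul]
    refine setIntegral_congr_fun (hBm k) fun x hx => ?_
    simp only [hf, hp, smul_eq_mul]
    rw [← kernel_mul_expDivKernel (hB0 k x hx)]
    have := (hcpos k).ne'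
    field_simp
  set I₀ : ℕ → ℝ := fun k => ∫ y in (WithLp.ofLp ⁻¹' (B k)), f y
      ∂(densityMeasure (volume : Measure (ℝ × F)) limitDensity) with hI₀
  have hI₀b : ∀ k, |I₀ k| ≤ 10 := by
    intro k
    have := norm_setIntegral_le_of_norm_le_const (μ := densityMeasure volume limitDensity)
      (s := WithLp.ofLp ⁻¹' (B k)) (f := f) (C := 10) (measure_lt_top _ _) (fun y _ => by
        rw [Real.norm_of_nonneg (expDivKernel_nonneg _)]; exact expDivKernel_le _)
    rw [Real.norm_eq_abs] at this
    refine this.trans ?_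
    have h1 : (densityMeasure (volume : Measure (ℝ × F)) limitDensity).real
      (WithLp.ofLp ⁻¹' (B k)) ≤ 1 := measureReal_le_one
    linarith
  -- Two errors: the weak convergence, multiplied by the convergent `σ k * c k`, and the error in `σ
  -- k * c k`, multiplied by the bounded `I₀ k`.
  have hfin : Tendsto (fun k => (σ k * c k) *
      (∫ y in (WithLp.ofLp ⁻¹' (B k)), f y ∂(densityMeasure (ν k) (p k)) - I₀ k) +
      (σ k * c k - 2 * Real.sqrt (2 * Real.pi)) * I₀ k) atTop (𝓝 0) := by
    have h1 := hclim.mul hmain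
    rw [mul_zero] at h1
    have h2 : Tendsto (fun k => (σ k * c k - 2 * Real.sqrt (2 * Real.pi)) * I₀ k) atTop (𝓝 0) := by
      have h0 : Tendsto (fun k => σ k * c k - 2 * Real.sqrt (2 * Real.pi)) atTop (𝓝 0) := by
        have := hclim.sub_const (2 * Real.sqrt (2 * Real.pi))
        rwa [sub_self] at this
      exact (bdd_le_mul_tendsto_zero' 10 (Eventually.of_forall hI₀b) h0).congr fun k => mul_comm _ _
    rw [← add_zero (0 : ℝ)]
    exact h1.add h2
  refine hfin.congr fun k => ?_
  rw [← hIk k]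
  simp only [hI₀]
  rw [hI0 k]
  have hpow : (2 * Real.pi) ^ (-((Module.finrank ℝ F : ℝ) + 1) / 2) =
      2 * Real.sqrt (2 * Real.pi) * ((4 * Real.pi)⁻¹ *
        (2 * Real.pi) ^ (-(Module.finrank ℝ F : ℝ) / 2)) := by
    have h2pi : 0 < 2 * Real.pi := by positivity
    have h1 : -((Module.finrank ℝ F : ℝ) + 1) / 2 = -(Module.finrank ℝ F : ℝ) / 2 + (1 / 2 - 1) := by
      ring
    rw [h1, Real.rpow_add h2pi, Real.rpow_sub h2pi, Real.rpow_one, ← Real.sqrt_eq_rpow]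
    field_simp
    ring
  rw [hpow]
  ring

end LocalLimit

/-! ### Truncated cones of vanishing slope -/

section Dilation

variable {F : Type*} [NormedAddCommGroup F] [InnerProductSpace ℝ F] [FiniteDimensional ℝ F]
  [MeasurableSpace F] [BorelSpace F]

/-- The truncated cone whose section at height `s ≥ 0` is the dilation of `D` by `1 + η s`. -/
def truncatedCone (η : ℝ) (D : Set F) : Set (ℝ × F) :=
  {x | 0 ≤ x.1 ∧ (1 + η * x.1)⁻¹ • x.2 ∈ D}

theorem measurableSet_truncatedCone (η : ℝ) {D : Set F} (hD : MeasurableSet D) :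
    MeasurableSet (truncatedCone η D) := by
  refine (measurableSet_le measurable_const measurable_fst).inter ?_
  have : Measurable fun x : ℝ × F => (1 + η * x.1)⁻¹ • x.2 := by fun_prop
  exact this hD

theorem convex_truncatedCone {η : ℝ} (hη : 0 ≤ η) {D : Set F} (hD : Convex ℝ D) :
    Convex ℝ (truncatedCone η D) := by
  rintro ⟨s, w⟩ ⟨hs, hw⟩ ⟨s', w'⟩ ⟨hs', hw'⟩ a b ha hb hab
  simp only at hs hw hs' hw'
  have h1 : 0 < 1 + η * s := by positivity
  have h2 : 0 < 1 + η * s' := by positivity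
  have h3 : 0 ≤ a * s + b * s' := by positivity
  have h4 : 0 < 1 + η * (a * s + b * s') := by positivity
  refine ⟨by simpa using h3, ?_⟩
  -- Dividing by the dilation factor at the combined height leaves a convex combination in `D`, with
  -- weights proportional to `a (1 + ηs)` and `b (1 + ηs')`; affinity of the factor makes them sum
  -- to one.
  have := hD hw hw' (a := a * (1 + η * s) / (1 + η * (a * s + b * s')))
    (b := b * (1 + η * s') / (1 + η * (a * s + b * s'))) (by positivity) (by positivity) (by
      rw [← add_div, div_eq_one_iff_eq h4.ne']
      linear_combination hab)
  convert this using 1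
  simp only [Prod.fst_add, Prod.smul_fst, Prod.snd_add, Prod.smul_snd, smul_eq_mul, smul_add,
    smul_smul]
  congr 2
  · field_simp
  · field_simp

/-- Dilations act continuously in `L¹` on the Gaussian density. An `L¹` bound controls all bases at
once, which is the source of uniformity in `D`. -/
theorem tendsto_integral_abs_dilated_gaussian_sub {ε : ℕ → ℝ} (hε0 : ∀ k, 0 ≤ ε k)
    (hε : Tendsto ε atTop (𝓝 0)) :
    Tendsto (fun k => ∫ w : F, |(1 + ε k) ^ Module.finrank ℝ F *
      Real.exp (-(1 / 2) * ‖(1 + ε k) • w‖ ^ 2) - Real.exp (-(1 / 2) * ‖w‖ ^ 2)|) atTop (𝓝 0) := by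
  rw [← integral_zero F ℝ (μ := volume)]
  refine tendsto_integral_filter_of_dominated_convergence
    (fun w => (2 ^ Module.finrank ℝ F + 1) * Real.exp (-(1 / 2) * ‖w‖ ^ 2)) ?_ ?_ ?_ ?_
  · exact Eventually.of_forall fun k => Continuous.aestronglyMeasurable (by fun_prop)
  · filter_upwards [hε.eventually_le_const one_pos] with k hk
    refine Eventually.of_forall fun w => ?_
    have h0 := hε0 k
    rw [Real.norm_eq_abs, abs_abs, add_mul, one_mul]
    refine (abs_sub _ _).trans ?_
    rw [abs_of_nonneg (by positivity), abs_of_nonneg (by positivity)]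
    gcongr ?_ * Real.exp ?_ + _
    · exact pow_le_pow_left₀ (by positivity) (by linarith) _
    · rw [norm_smul, Real.norm_of_nonneg (by positivity)]
      have : ‖w‖ ≤ (1 + ε k) * ‖w‖ := by nlinarith [norm_nonneg w]
      have := pow_le_pow_left₀ (norm_nonneg w) this 2
      linarith
  · exact integrable_exp_neg_half_mul_norm_sq.const_mul _
  · refine Eventually.of_forall fun w => ?_
    have hc : Continuous fun e : ℝ => |(1 + e) ^ Module.finrank ℝ F *
        Real.exp (-(1 / 2) * ‖(1 + e) • w‖ ^ 2) - Real.exp (-(1 / 2) * ‖w‖ ^ 2)| := by fun_prop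
    have := (hc.tendsto 0).comp hε
    simpa [Function.comp_def] using this

theorem setIntegral_dilated_gaussian {D : Set F} (hD : MeasurableSet D) {r : ℝ} (hr : 0 < r) :
    ∫ w : F, D.indicator (fun _ => (1 : ℝ)) (r⁻¹ • w) * Real.exp (-(1 / 2) * ‖w‖ ^ 2) =
      ∫ w in D, r ^ Module.finrank ℝ F * Real.exp (-(1 / 2) * ‖r • w‖ ^ 2) := by
  have h := Measure.integral_comp_smul (volume : Measure F)
    (fun w => D.indicator (fun _ => (1 : ℝ)) (r⁻¹ • w) * Real.exp (-(1 / 2) * ‖w‖ ^ 2)) r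
  rw [← integral_indicator hD]
  have h2 : ∀ w, D.indicator (fun w => r ^ Module.finrank ℝ F *
      Real.exp (-(1 / 2) * ‖r • w‖ ^ 2)) w = r ^ Module.finrank ℝ F *
      (D.indicator (fun _ => (1 : ℝ)) (r⁻¹ • r • w) * Real.exp (-(1 / 2) * ‖r • w‖ ^ 2)) := by
    intro w
    rw [inv_smul_smul₀ hr.ne']
    by_cases hw : w ∈ D <;> simp [hw]
  simp_rw [h2]
  rw [integral_const_mul, h, abs_of_pos (by positivity), smul_eq_mul, ← mul_assoc,
    mul_inv_cancel₀ (by positivity), one_mul]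

/-- The mass of a truncated cone with small opening is close to the Gaussian mass of its base,
uniformly in the base. -/
theorem tendsto_setIntegral_truncatedCone_sub {η : ℕ → ℝ} (hη0 : ∀ k, 0 ≤ η k)
    (hη : Tendsto η atTop (𝓝 0)) {D : ℕ → Set F} (hD : ∀ k, MeasurableSet (D k)) :
    Tendsto (fun k => (∫ x in truncatedCone (η k) (D k),
        Real.exp (-x.1) * Real.exp (-(1 / 2) * ‖x.2‖ ^ 2)) -
      ∫ w in D k, Real.exp (-(1 / 2) * ‖w‖ ^ 2)) atTop (𝓝 0) := by
  have hgi := integrable_exp_neg_half_mul_norm_sq (F := F)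
  set H : ℕ → ℝ → ℝ := fun k s => ∫ w : F, (D k).indicator (fun _ => (1 : ℝ))
    ((1 + η k * s)⁻¹ • w) * Real.exp (-(1 / 2) * ‖w‖ ^ 2) with hH
  set H₀ : ℕ → ℝ := fun k => ∫ w in D k, Real.exp (-(1 / 2) * ‖w‖ ^ 2) with hH₀
  set C : ℝ := ∫ w : F, Real.exp (-(1 / 2) * ‖w‖ ^ 2) with hC
  have hexp : IntegrableOn (fun s : ℝ => Real.exp (-s)) (Set.Ici 0) :=
    (integrableOn_Ici_iff_integrableOn_Ioi).2 (integrableOn_exp_neg_Ioi 0)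
  have hind01 : ∀ k (w : F), (D k).indicator (fun _ => (1 : ℝ)) w ∈ Set.Icc (0 : ℝ) 1 := by
    intro k w
    by_cases hw : w ∈ D k <;> simp [hw]
  have hint : ∀ k, Integrable (fun x : ℝ × F => Real.exp (-x.1) *
      ((D k).indicator (fun _ => (1 : ℝ)) ((1 + η k * x.1)⁻¹ • x.2) *
        Real.exp (-(1 / 2) * ‖x.2‖ ^ 2))) ((volume.restrict (Set.Ici 0)).prod volume) := by
    intro k
    have hmeas : Measurable fun x : ℝ × F =>
        (D k).indicator (fun _ => (1 : ℝ)) ((1 + η k * x.1)⁻¹ • x.2) :=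
      (measurable_const.indicator (hD k)).comp (by fun_prop)
    refine (hexp.mul_prod hgi).mono' ?_ (Eventually.of_forall fun x => ?_)
    · exact Measurable.aestronglyMeasurable (by fun_prop)
    · have := hind01 k ((1 + η k * x.1)⁻¹ • x.2)
      rw [norm_mul, norm_mul, Real.norm_of_nonneg (Real.exp_pos _).le,
        Real.norm_of_nonneg (Real.exp_pos _).le, Real.norm_of_nonneg this.1]
      gcongr
      exact mul_le_of_le_one_left (Real.exp_pos _).le this.2
  have hcone : ∀ k, ∫ x in truncatedCone (η k) (D k),
      Real.exp (-x.1) * Real.exp (-(1 / 2) * ‖x.2‖ ^ 2) =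
      ∫ s in Set.Ici (0 : ℝ), Real.exp (-s) * H k s := by
    intro k
    have h1 : ∫ x in truncatedCone (η k) (D k),
        Real.exp (-x.1) * Real.exp (-(1 / 2) * ‖x.2‖ ^ 2) =
        ∫ x in (Set.Ici (0 : ℝ)) ×ˢ (Set.univ : Set F), Real.exp (-x.1) *
          ((D k).indicator (fun _ => (1 : ℝ)) ((1 + η k * x.1)⁻¹ • x.2) *
            Real.exp (-(1 / 2) * ‖x.2‖ ^ 2)) := by
      rw [← integral_indicator (measurableSet_truncatedCone _ (hD k)),
        ← integral_indicator (measurableSet_Ici.prod MeasurableSet.univ)]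
      refine integral_congr_ae (Eventually.of_forall fun x => ?_)
      by_cases hx0 : 0 ≤ x.1
      · by_cases hx : (1 + η k * x.1)⁻¹ • x.2 ∈ D k <;> simp [truncatedCone, Set.indicator, hx0, hx]
      · simp [truncatedCone, Set.indicator, hx0]
    rw [h1, Measure.volume_eq_prod, ← Measure.prod_restrict, Measure.restrict_univ,
      integral_prod _ (hint k)]
    simp only [hH]
    simp_rw [integral_const_mul]
  have hHnn : ∀ k s, 0 ≤ H k s ∧ H k s ≤ C := by
    intro k s
    refine ⟨integral_nonneg fun w => mul_nonneg (hind01 k _).1 (Real.exp_pos _).le, ?_⟩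
    refine integral_mono_of_nonneg
      (Eventually.of_forall fun w => mul_nonneg (hind01 k _).1 (Real.exp_pos _).le) hgi
      (Eventually.of_forall fun w => mul_le_of_le_one_left (Real.exp_pos _).le (hind01 k _).2)
  have hH₀nn : ∀ k, 0 ≤ H₀ k ∧ H₀ k ≤ C := fun k =>
    ⟨integral_nonneg fun w => (Real.exp_pos _).le,
      setIntegral_le_integral hgi (Eventually.of_forall fun w => (Real.exp_pos _).le)⟩
  have hHint : ∀ k, IntegrableOn (fun s => Real.exp (-s) * H k s) (Set.Ici 0) := by
    intro k
    have := (hint k).integral_prod_left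
    simp_rw [integral_const_mul] at this
    exact this
  -- As `exp (-s)` has mass one on the half-line, the mass of the base can be subtracted under the
  -- height integral.
  have hlimit : Tendsto (fun k => ∫ s in Set.Ici (0 : ℝ), Real.exp (-s) * (H k s - H₀ k)) atTop
      (𝓝 (∫ s in Set.Ici (0 : ℝ), (0 : ℝ))) := by
    refine tendsto_integral_of_dominated_convergence (fun s => Real.exp (-s) * C) (fun k => ?_)
      (hexp.mul_const C) (fun k => Eventually.of_forall fun s => ?_) ?_
    · have := ((hHint k).sub (hexp.mul_const (H₀ k))).aestronglyMeasurable
      refine this.congr (Eventually.of_forall fun s => ?_)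
      simp [mul_sub]
    · rw [norm_mul, Real.norm_of_nonneg (Real.exp_pos _).le]
      gcongr
      rw [Real.norm_eq_abs, abs_le]
      constructor <;> linarith [hHnn k s, hH₀nn k, (hHnn k s).1, (hHnn k s).2, (hH₀nn k).1,
        (hH₀nn k).2]
    · refine (ae_restrict_iff' measurableSet_Ici).2 (Eventually.of_forall fun s hs => ?_)
      have hs0 : (0 : ℝ) ≤ s := hs
      have he0 : ∀ k, 0 ≤ η k * s := fun k => mul_nonneg (hη0 k) hs0
      have he : Tendsto (fun k => η k * s) atTop (𝓝 0) := by
        simpa using hη.mul_const s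
      have hΔ := tendsto_integral_abs_dilated_gaussian_sub (F := F) he0 he
      have hdiff : Tendsto (fun k => H k s - H₀ k) atTop (𝓝 0) := by
        refine squeeze_zero_norm (fun k => ?_) hΔ
        have hr : 0 < 1 + η k * s := by linarith [he0 k]
        have hgi' : Integrable fun w : F => (1 + η k * s) ^ Module.finrank ℝ F *
            Real.exp (-(1 / 2) * ‖(1 + η k * s) • w‖ ^ 2) :=
          (hgi.comp_smul hr.ne').const_mul _
        simp only [hH, hH₀]
        rw [setIntegral_dilated_gaussian (hD k) hr, ← integral_sub hgi'.integrableOn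
          hgi.integrableOn]
        refine (norm_integral_le_integral_norm _).trans ?_
        exact setIntegral_le_integral (hgi'.sub hgi).abs
          (Eventually.of_forall fun w => abs_nonneg _)
      simpa using hdiff.const_mul (Real.exp (-s))
  rw [integral_zero] at hlimit
  refine hlimit.congr fun k => ?_
  rw [hcone k]
  simp_rw [mul_sub]
  rw [integral_sub (hHint k) (hexp.mul_const _), integral_mul_const, integral_Ici_eq_integral_Ioi,
    integral_Ici_eq_integral_Ioi, integral_exp_neg_Ioi_zero, one_mul]

end Dilation

/-! ### Cauchy estimates for the limiting function -/

section Gradient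

variable {d : ℕ}

theorem isOpen_multiStrip (a b : Fin d → EReal) : IsOpen (multiStrip a b) := by
  have : multiStrip a b = ⋂ i, {z : Fin d → ℂ | a i < ((z i).re : EReal) ∧ ((z i).re : EReal) < b i} := by
    ext z; simp [multiStrip]
  rw [this]
  refine isOpen_iInter_of_finite fun i => ?_
  have hc : Continuous fun z : Fin d → ℂ => ((z i).re : EReal) :=
    continuous_coe_real_ereal.comp (Complex.continuous_re.comp (continuous_apply i))
  exact (isOpen_lt continuous_const hc).inter (isOpen_lt hc continuous_const)

theorem toComplexVec_mem_multiStrip {a b : Fin d → EReal} {h : EuclideanSpace ℝ (Fin d)}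
    (hh : h ∈ realBox a b) : toComplexVec h ∈ multiStrip a b := by
  intro i
  simpa [toComplexVec] using hh i

theorem continuous_toComplexVec : Continuous (toComplexVec (d := d)) := by
  unfold toComplexVec; fun_prop

theorem laplaceResidue_one {Ω : Type*} [MeasurableSpace Ω] (P : Measure Ω)
    (X : Ω → EuclideanSpace ℝ (Fin d)) (t : ℝ) (z : Fin d → ℂ) :
    laplaceResidue P X t 1 z = (∫ ω, Complex.exp (∑ i, z i * (X ω i : ℂ)) ∂P) *
      Complex.exp (-((t : ℂ) * (∑ i, z i * z i) / 2)) := by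
  rw [laplaceResidue, Matrix.map_one _ Complex.ofReal_zero Complex.ofReal_one, Matrix.one_mulVec]
  rfl

theorem sum_toComplexVec_mul (h x : EuclideanSpace ℝ (Fin d)) :
    ∑ i, toComplexVec h i * (x i : ℂ) = ((inner ℝ h x : ℝ) : ℂ) := by
  rw [PiLp.inner_apply]
  simp [toComplexVec, mul_comm]

theorem integrable_exp_inner {Ω : Type*} [MeasurableSpace Ω] {P : Measure Ω}
    {X : Ω → EuclideanSpace ℝ (Fin d)} {h : EuclideanSpace ℝ (Fin d)}
    (hi : Integrable (fun ω => Complex.exp (∑ i, toComplexVec h i * (X ω i : ℂ))) P) :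
    Integrable (fun ω => Real.exp (inner ℝ h (X ω))) P := by
  refine hi.norm.congr (Eventually.of_forall fun ω => ?_)
  simp only
  rw [sum_toComplexVec_mul, ← Complex.ofReal_exp, Complex.norm_real,
    Real.norm_of_nonneg (Real.exp_pos _).le]

/-- The residues are holomorphic along complex coordinate lines through real points. -/
theorem differentiableOn_laplaceResidue_line {Ω : Type*} [MeasurableSpace Ω] {P : Measure Ω}
    [IsProbabilityMeasure P] {X : Ω → EuclideanSpace ℝ (Fin d)} (t : ℝ)
    {h : EuclideanSpace ℝ (Fin d)} {i : Fin d} {ε : ℝ}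
    (hi : ∀ l : ℂ, ‖l‖ < ε → Integrable (fun ω =>
      Complex.exp (∑ j, (toComplexVec h + l • (Pi.single i 1 : Fin d → ℂ)) j * (X ω j : ℂ))) P) :
    DifferentiableOn ℂ (fun l : ℂ => laplaceResidue P X t 1
      (toComplexVec h + l • (Pi.single i 1 : Fin d → ℂ))) (Metric.ball 0 ε) := by
  by_cases hε : 0 < ε
  swap
  · rw [Metric.ball_eq_empty.2 (not_lt.1 hε)]
    exact differentiableOn_empty
  have hsum : ∀ (l : ℂ) (ω : Ω),
      ∑ j, (toComplexVec h + l • (Pi.single i 1 : Fin d → ℂ)) j * (X ω j : ℂ) =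
      ((inner ℝ h (X ω) : ℝ) : ℂ) + l * (X ω i : ℂ) := by
    intro l ω
    rw [← sum_toComplexVec_mul]
    simp [add_mul, Finset.sum_add_distrib, Pi.single_apply]
  have hint0 : Integrable (fun ω => Real.exp (inner ℝ h (X ω))) P := by
    refine integrable_exp_inner ?_
    simpa using hi 0 (by simpa using hε)
  set m : ℝ := ∫ ω, Real.exp (inner ℝ h (X ω)) ∂P with hm
  have hmpos : 0 < m := integral_exp_pos hint0
  set Q : Measure Ω := P.tilted fun ω => inner ℝ h (X ω) with hQ
  have hmgf : ∀ l : ℂ, ∫ ω, Complex.exp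
      (∑ j, (toComplexVec h + l • (Pi.single i 1 : Fin d → ℂ)) j * (X ω j : ℂ)) ∂P =
      m * ProbabilityTheory.complexMGF (fun ω => X ω i) Q l := by
    intro l
    rw [ProbabilityTheory.complexMGF, hQ, integral_tilted, ← integral_const_mul]
    refine integral_congr_ae (Eventually.of_forall fun ω => ?_)
    simp only
    rw [hsum, Complex.exp_add, ← hm, Complex.real_smul, ← Complex.ofReal_exp]
    push_cast
    have : (m : ℂ) ≠ 0 := by exact_mod_cast hmpos.ne'
    field_simp
  have hset : ∀ l : ℂ, ‖l‖ < ε → l.re ∈ interior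
      (ProbabilityTheory.integrableExpSet (fun ω => X ω i) Q) := by
    intro l hl
    have hsub : Set.Ioo (-ε) ε ⊆ ProbabilityTheory.integrableExpSet (fun ω => X ω i) Q := by
      intro u hu
      have hu' : ‖(u : ℂ)‖ < ε := by
        rw [Complex.norm_real, Real.norm_eq_abs, abs_lt]; exact hu
      have h1 := (hi u hu').norm
      simp only [ProbabilityTheory.integrableExpSet, Set.mem_ofPred_eq]
      rw [hQ, integrable_tilted_iff]
      · refine h1.congr (Eventually.of_forall fun ω => ?_)
        simp only
        rw [hsum, smul_eq_mul, Complex.norm_exp, ← Real.exp_add]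
        congr 1
        simp
      · exact hint0
    refine interior_mono hsub ?_
    rw [isOpen_Ioo.interior_eq]
    exact abs_lt.1 ((Complex.abs_re_le_norm l).trans_lt hl)
  have h1 : DifferentiableOn ℂ (ProbabilityTheory.complexMGF (fun ω => X ω i) Q)
      (Metric.ball 0 ε) := by
    refine (ProbabilityTheory.differentiableOn_complexMGF).mono fun l hl => ?_
    exact hset l (by simpa using hl)
  simp_rw [laplaceResidue_one, hmgf]
  refine (h1.const_mul _).mul (Differentiable.differentiableOn ?_)
  simp only [Pi.add_apply, Pi.smul_apply, smul_eq_mul]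
  fun_prop

variable {Ω : ℕ → Type*} [∀ n, MeasurableSpace (Ω n)]
    {P : ∀ n, Measure (Ω n)} [∀ n, IsProbabilityMeasure (P n)]
    {X : ∀ n, Ω n → EuclideanSpace ℝ (Fin d)} {t : ℕ → ℝ} {a b : Fin d → EReal}
    {ψ : (Fin d → ℂ) → ℂ}

/-- Local Cauchy estimate for the partial derivatives of the limiting function at real points. -/
theorem exists_nhds_norm_fderiv_single_le
    (hmod : IsModGaussian P X t 1 a b ψ)
    {h₀ : EuclideanSpace ℝ (Fin d)} (hh₀ : h₀ ∈ realBox a b) :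
    ∃ U ∈ 𝓝 h₀, ∃ c : ℝ, ∀ h ∈ U, ∀ i,
      ‖fderiv ℂ ψ (toComplexVec h) (Pi.single i 1)‖ ≤ c := by
  set z₀ := toComplexVec h₀ with hz₀
  have hopen := isOpen_multiStrip a b
  have hz₀m : z₀ ∈ multiStrip a b := toComplexVec_mem_multiStrip hh₀
  have hcont : ContinuousAt ψ z₀ := hmod.continuousOn.continuousAt (hopen.mem_nhds hz₀m)
  have hbd : ∀ᶠ z in 𝓝 z₀, ‖ψ z‖ < ‖ψ z₀‖ + 1 :=
    hcont.norm.eventually_lt_const (lt_add_one _)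
  obtain ⟨ε, hε, hball⟩ := Metric.eventually_nhds_iff_ball.1 (hbd.and (hopen.mem_nhds hz₀m))
  refine ⟨toComplexVec ⁻¹' Metric.ball z₀ (ε / 2),
    continuous_toComplexVec.continuousAt.preimage_mem_nhds (Metric.ball_mem_nhds _ (by positivity)),
    (‖ψ z₀‖ + 1) / (ε / 4), fun h hh i => ?_⟩
  have hline : ∀ l : ℂ, ‖l‖ < ε / 2 →
      toComplexVec h + l • (Pi.single i 1 : Fin d → ℂ) ∈ Metric.ball z₀ ε := by
    intro l hl
    rw [Set.mem_preimage, Metric.mem_ball, dist_eq_norm] at hh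
    rw [Metric.mem_ball, dist_eq_norm, add_sub_right_comm]
    refine (norm_add_le _ _).trans_lt ?_
    rw [norm_smul, Pi.norm_single, norm_one, mul_one]
    linarith
  -- Only continuity of `ψ` is given; holomorphy along the line passes to locally uniform limits of
  -- the residues.
  have hdiff : DifferentiableOn ℂ (fun l : ℂ => ψ (toComplexVec h + l • (Pi.single i 1 : Fin d → ℂ)))
      (Metric.ball 0 (ε / 2)) := by
    have hlim := hmod.tendsto_residue.comp
      (fun l : ℂ => toComplexVec h + l • (Pi.single i 1 : Fin d → ℂ)) (t := Metric.ball 0 (ε / 2))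
      (fun l hl => (hball _ (hline l (by simpa using hl))).2)
      (Continuous.continuousOn (by fun_prop))
    refine hlim.differentiableOn (Eventually.of_forall fun n => ?_) Metric.isOpen_ball
    exact differentiableOn_laplaceResidue_line (t n) fun l hl =>
      hmod.integrable n _ (hball _ (hline l hl)).2
  have hc : 0 ≤ (‖ψ z₀‖ + 1) / (ε / 4) := by positivity
  -- The line derivative represents `fderiv` when `ψ` is jointly differentiable; otherwise `fderiv`
  -- is zero by convention and the bound is trivial.
  by_cases hd : DifferentiableAt ℂ ψ (toComplexVec h)
  · have hder : deriv (fun l : ℂ => ψ (toComplexVec h + l • (Pi.single i 1 : Fin d → ℂ))) 0 =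
        fderiv ℂ ψ (toComplexVec h) (Pi.single i 1) := by
      have h1 : HasDerivAt (fun l : ℂ => toComplexVec h + l • (Pi.single i 1 : Fin d → ℂ))
          (Pi.single i 1) 0 := by
        simpa using ((hasDerivAt_id (0 : ℂ)).smul_const (Pi.single i 1 : Fin d → ℂ)).const_add
          (toComplexVec h)
      have h2 : HasFDerivAt ψ (fderiv ℂ ψ (toComplexVec h))
          (toComplexVec h + (0 : ℂ) • (Pi.single i 1 : Fin d → ℂ)) := by
        simpa using hd.hasFDerivAt
      exact (h2.comp_hasDerivAt 0 h1).deriv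
    rw [← hder]
    refine Complex.norm_deriv_le_of_forall_mem_sphere_norm_le (by positivity)
      (hdiff.mono ?_).diffContOnCl fun l hl => ?_
    · rw [closure_ball _ (by positivity)]
      exact Metric.closedBall_subset_ball (by linarith)
    · rw [mem_sphere_zero_iff_norm] at hl
      exact (hball _ (hline l (by linarith))).1.le
  · rw [fderiv_zero_of_not_differentiableAt hd]
    simpa using hc

/-- Compactness makes the local Cauchy estimates uniform and keeps `ψ` away from zero. A bound
linear in `‖x‖` suffices, since the Gaussian weight restricts to `‖x‖ ~ 1/√t`. -/
theorem exists_norm_gradPairing_div_le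
    (hmod : IsModGaussian P X t 1 a b ψ)
    (hψ : ∀ x ∈ realBox a b, ψ (toComplexVec x) ≠ 0)
    {K : Set (EuclideanSpace ℝ (Fin d))} (hK : IsCompact K) (hKbox : K ⊆ realBox a b) :
    ∃ c : ℝ, 0 ≤ c ∧ ∀ h ∈ K, ∀ x,
      ‖gradPairing ψ (toComplexVec h) x / ψ (toComplexVec h)‖ ≤ c * ‖x‖ := by
  have h1 : ∃ c : ℝ, ∀ h ∈ K, ∀ i, ‖fderiv ℂ ψ (toComplexVec h) (Pi.single i 1)‖ ≤ c := by
    refine hK.induction_on ⟨0, by simp⟩ (fun s u hsu ⟨c, hc⟩ => ⟨c, fun h hh => hc h (hsu hh)⟩)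
      (fun s u ⟨c, hc⟩ ⟨c', hc'⟩ => ⟨max c c', ?_⟩) fun h hh => ?_
    · rintro h (hh | hh) i
      · exact (hc h hh i).trans (le_max_left _ _)
      · exact (hc' h hh i).trans (le_max_right _ _)
    · obtain ⟨U, hU, c, hc⟩ := exists_nhds_norm_fderiv_single_le hmod (hKbox hh)
      exact ⟨U, mem_nhdsWithin_of_mem_nhds hU, c, hc⟩
  have h2 : ∃ c : ℝ, ∀ h ∈ K, ‖(ψ (toComplexVec h))⁻¹‖ ≤ c := by
    refine hK.exists_bound_of_continuousOn ?_
    refine ContinuousOn.inv₀ ?_ fun h hh => hψ h (hKbox hh)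
    exact hmod.continuousOn.comp continuous_toComplexVec.continuousOn fun h hh =>
      toComplexVec_mem_multiStrip (hKbox hh)
  obtain ⟨c₁, hc₁⟩ := h1
  obtain ⟨c₂, hc₂⟩ := h2
  refine ⟨(d * max c₁ 0) * max c₂ 0, by positivity, fun h hh x => ?_⟩
  rw [div_eq_mul_inv, norm_mul, mul_right_comm]
  refine mul_le_mul ?_ ((hc₂ h hh).trans (le_max_left _ _)) (norm_nonneg _) (by positivity)
  rw [gradPairing]
  refine (norm_sum_le _ _).trans ?_
  calc ∑ i, ‖fderiv ℂ ψ (toComplexVec h) (Pi.single i 1) * (x i : ℂ)‖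
      ≤ ∑ _i : Fin d, max c₁ 0 * ‖x‖ := by
        refine Finset.sum_le_sum fun i _ => ?_
        rw [norm_mul, Complex.norm_real]
        exact mul_le_mul ((hc₁ h hh i).trans (le_max_left _ _)) (PiLp.norm_apply_le x i)
          (norm_nonneg _) (by positivity)
    _ = d * max c₁ 0 * ‖x‖ := by simp [mul_assoc]

end Gradient

/-! ### Coordinates adapted to the direction `h` -/

section Geometry

variable {d m : ℕ}

/-- Orthonormal coordinates on the hyperplane orthogonal to `h`. -/
theorem exists_isometry_orthogonal (hd : d = m + 1) {h : EuclideanSpace ℝ (Fin d)} (hh : h ≠ 0) :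
    ∃ ι : EuclideanSpace ℝ (Fin m) →ₗᵢ[ℝ] EuclideanSpace ℝ (Fin d),
      (∀ x, x ∈ (ℝ ∙ h)ᗮ ↔ ∃ w, ι w = x) ∧ perpMeasure h = Measure.map ι volume := by
  have hfin : Module.finrank ℝ (ℝ ∙ h)ᗮ = m := by
    have h1 := (ℝ ∙ h).finrank_add_finrank_orthogonal
    rw [finrank_span_singleton hh, finrank_euclideanSpace_fin] at h1
    omega
  set e := (stdOrthonormalBasis ℝ (ℝ ∙ h)ᗮ).reindex (finCongr hfin) with he
  refine ⟨(ℝ ∙ h)ᗮ.subtypeₗᵢ.comp e.repr.symm.toLinearIsometry, fun x => ⟨fun hx => ?_, ?_⟩, ?_⟩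
  · exact ⟨e.repr ⟨x, hx⟩, by simp⟩
  · rintro ⟨w, rfl⟩
    simp
  · rw [perpMeasure, (stdOrthonormalBasis ℝ (ℝ ∙ h)ᗮ).addHaar_eq_volume,
      ← e.repr.symm.measurePreserving.map_eq, Measure.map_map (by fun_prop) (by fun_prop)]
    rfl

variable {h : EuclideanSpace ℝ (Fin d)} {ι : EuclideanSpace ℝ (Fin m) →ₗᵢ[ℝ] EuclideanSpace ℝ (Fin d)}

/-- The coordinates of the orthogonal projection. -/
noncomputable def coord (ι : EuclideanSpace ℝ (Fin m) →ₗᵢ[ℝ] EuclideanSpace ℝ (Fin d)) :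
    EuclideanSpace ℝ (Fin d) →L[ℝ] EuclideanSpace ℝ (Fin m) :=
  ContinuousLinearMap.adjoint ι.toContinuousLinearMap

theorem inner_coord (x : EuclideanSpace ℝ (Fin d)) (w : EuclideanSpace ℝ (Fin m)) :
    inner ℝ (coord ι x) w = inner ℝ x (ι w) := by
  rw [coord, ContinuousLinearMap.adjoint_inner_left]
  rfl

theorem coord_apply_isometry (w : EuclideanSpace ℝ (Fin m)) : coord ι (ι w) = w := by
  refine ext_inner_right ℝ fun v => ?_
  rw [inner_coord, ι.inner_map_map]

theorem inner_isometry_eq_zero (hι : ∀ x, x ∈ (ℝ ∙ h)ᗮ ↔ ∃ w, ι w = x)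
    (w : EuclideanSpace ℝ (Fin m)) : inner ℝ h (ι w) = 0 :=
  (Submodule.mem_orthogonal_singleton_iff_inner_right).1 ((hι _).2 ⟨w, rfl⟩)

theorem coord_self (hι : ∀ x, x ∈ (ℝ ∙ h)ᗮ ↔ ∃ w, ι w = x) : coord ι h = 0 := by
  refine ext_inner_right ℝ fun v => ?_
  rw [inner_coord, inner_isometry_eq_zero hι, inner_zero_left]

theorem isometry_coord (hι : ∀ x, x ∈ (ℝ ∙ h)ᗮ ↔ ∃ w, ι w = x) (hh : h ≠ 0)
    (x : EuclideanSpace ℝ (Fin d)) : ι (coord ι x) = x - (inner ℝ h x / ‖h‖ ^ 2) • h := by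
  have hpos : 0 < ‖h‖ := norm_pos_iff.2 hh
  obtain ⟨w, hw⟩ := (hι (x - (inner ℝ h x / ‖h‖ ^ 2) • h)).1 (by
    rw [Submodule.mem_orthogonal_singleton_iff_inner_right, inner_sub_right, real_inner_smul_right,
      real_inner_self_eq_norm_sq]
    field_simp
    ring)
  have : coord ι x = w := by
    rw [← coord_apply_isometry (ι := ι) w, hw, map_sub, map_smul, coord_self hι, smul_zero, sub_zero]
  rw [this, hw]

/-- The base of the rescaled cone in the coordinates of the orthogonal hyperplane. -/
def scaledBase (ι : EuclideanSpace ℝ (Fin m) →ₗᵢ[ℝ] EuclideanSpace ℝ (Fin d)) (t : ℝ)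
    (D : Set (EuclideanSpace ℝ (Fin d))) : Set (EuclideanSpace ℝ (Fin m)) :=
  {w | ι ((√t)⁻¹ • w) ∈ D}

theorem convex_scaledBase (t : ℝ) {D : Set (EuclideanSpace ℝ (Fin d))} (hD : Convex ℝ D) :
    Convex ℝ (scaledBase ι t D) := by
  intro x hx y hy a b ha hb hab
  have := hD hx hy ha hb hab
  rw [← map_smul, ← map_smul, ← map_add, smul_comm a, smul_comm b, ← smul_add] at this
  exact this

theorem measurableSet_scaledBase (t : ℝ) {D : Set (EuclideanSpace ℝ (Fin d))}
    (hD : MeasurableSet D) : MeasurableSet (scaledBase ι t D) := by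
  have : Measurable fun w : EuclideanSpace ℝ (Fin m) => ι ((√t)⁻¹ • w) :=
    (ι.continuous.comp (continuous_const_smul _)).measurable
  exact this hD

/-- The rescaled coordinates in which the Gaussian fluctuations have a limit. -/
noncomputable def scaledCoord (ι : EuclideanSpace ℝ (Fin m) →ₗᵢ[ℝ] EuclideanSpace ℝ (Fin d)) (t : ℝ)
    (h x : EuclideanSpace ℝ (Fin d)) : ℝ × EuclideanSpace ℝ (Fin m) :=
  (inner ℝ h x - t * ‖h‖ ^ 2, (√t)⁻¹ • coord ι x)

theorem continuous_scaledCoord (t : ℝ) : Continuous (scaledCoord ι t h) := by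
  unfold scaledCoord; fun_prop

/-- The point `t r (h + y)` has height `s = t (r - 1) ‖h‖²`, so `r = 1 + s / (t‖h‖²)`, and its
rescaled orthogonal part is `r √t y`. Thus `r ≥ 1` means `s ≥ 0`, and the section at height `s` is
the base dilated by `r`. -/
theorem mem_smul_coneOver_iff (hι : ∀ x, x ∈ (ℝ ∙ h)ᗮ ↔ ∃ w, ι w = x) (hh : h ≠ 0) {t : ℝ}
    (ht : 0 < t) {D : Set (EuclideanSpace ℝ (Fin d))} (hD : D ⊆ (ℝ ∙ h)ᗮ)
    (x : EuclideanSpace ℝ (Fin d)) :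
    x ∈ t • coneOver ((fun y => y + h) '' D) ↔
      scaledCoord ι t h x ∈ truncatedCone (1 / (t * ‖h‖ ^ 2)) (scaledBase ι t D) := by
  have hpos : 0 < ‖h‖ := norm_pos_iff.2 hh
  have hsq : √t * √t = t := Real.mul_self_sqrt ht.le
  have hs0 : 0 < √t := Real.sqrt_pos.2 ht
  simp only [truncatedCone, scaledBase, scaledCoord, Set.mem_ofPred_eq]
  constructor
  · rintro ⟨_, ⟨r, hr, _, ⟨y, hy, rfl⟩, rfl⟩, rfl⟩
    have hr0 : 0 < r := by linarith
    obtain ⟨w, rfl⟩ := (hι y).1 (hD hy)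
    have hin : inner ℝ h (t • r • (ι w + h)) = t * (r * ‖h‖ ^ 2) := by
      rw [real_inner_smul_right, real_inner_smul_right, inner_add_right,
        inner_isometry_eq_zero hι, zero_add, real_inner_self_eq_norm_sq]
    have hco : coord ι (t • r • (ι w + h)) = t • r • w := by
      rw [map_smul, map_smul, map_add, coord_apply_isometry, coord_self hι, add_zero]
    simp only
    rw [hin, hco]
    refine ⟨?_, ?_⟩
    · have : 0 ≤ t * ((r - 1) * ‖h‖ ^ 2) := by
        have : 0 ≤ r - 1 := by linarith
        positivity
      linarith
    · have h1 : 1 + 1 / (t * ‖h‖ ^ 2) * (t * (r * ‖h‖ ^ 2) - t * ‖h‖ ^ 2) = r := by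
        field_simp; ring
      have h2 : (√t)⁻¹ • r⁻¹ • (√t)⁻¹ • t • r • w = w := by
        simp only [smul_smul]
        have : (√t)⁻¹ * (r⁻¹ * ((√t)⁻¹ * (t * r))) = 1 := by
          field_simp
          rw [sq, hsq]
        rw [this, one_smul]
      rw [h1, h2]
      exact hy
  · rintro ⟨h1, h2⟩
    set r : ℝ := 1 + 1 / (t * ‖h‖ ^ 2) * (inner ℝ h x - t * ‖h‖ ^ 2) with hr
    have hr1 : 1 ≤ r := by
      have : 0 ≤ 1 / (t * ‖h‖ ^ 2) * (inner ℝ h x - t * ‖h‖ ^ 2) := by positivity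
      linarith
    have hr0 : 0 < r := by linarith
    refine ⟨r • (ι ((√t)⁻¹ • r⁻¹ • (√t)⁻¹ • coord ι x) + h),
      ⟨r, hr1, _, ⟨_, h2, rfl⟩, rfl⟩, ?_⟩
    have h3 : t * r = inner ℝ h x / ‖h‖ ^ 2 := by rw [hr]; field_simp; ring
    simp only
    rw [map_smul, map_smul, map_smul, isometry_coord hι hh, smul_smul t r, ← h3]
    simp only [smul_add, smul_smul]
    have h4 : t * r * ((√t)⁻¹ * (r⁻¹ * (√t)⁻¹)) = 1 := by
      field_simp
      rw [sq, hsq]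
    rw [h4, one_smul, sub_add_cancel]

end Geometry

/-! ### Exponential change of measure -/

section Tilting

variable {d m : ℕ} {Ω : Type*} [MeasurableSpace Ω] {P : Measure Ω} [IsProbabilityMeasure P]
  {X : Ω → EuclideanSpace ℝ (Fin d)} {t : ℝ} {h : EuclideanSpace ℝ (Fin d)}
  {ι : EuclideanSpace ℝ (Fin m) →ₗᵢ[ℝ] EuclideanSpace ℝ (Fin d)}

theorem laplaceResidue_toComplexVec :
    laplaceResidue P X t 1 (toComplexVec h) =
      (((∫ ω, Real.exp (inner ℝ h (X ω)) ∂P) * Real.exp (-(t * ‖h‖ ^ 2 / 2)) : ℝ) : ℂ) := by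
  rw [laplaceResidue_one, Complex.ofReal_mul, ← integral_complex_ofReal]
  simp_rw [sum_toComplexVec_mul]
  have : ∑ i, toComplexVec h i * toComplexVec h i = ((‖h‖ ^ 2 : ℝ) : ℂ) := by
    have := sum_toComplexVec_mul h h
    rwa [real_inner_self_eq_norm_sq] at this
  rw [this]
  push_cast
  rfl

/-- The law of the rescaled coordinates under the tilted measure. -/
noncomputable def tiltedLaw (P : Measure Ω) (X : Ω → EuclideanSpace ℝ (Fin d)) (t : ℝ)
    (h : EuclideanSpace ℝ (Fin d))
    (ι : EuclideanSpace ℝ (Fin m) →ₗᵢ[ℝ] EuclideanSpace ℝ (Fin d)) :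
    Measure (ℝ × EuclideanSpace ℝ (Fin m)) :=
  (P.tilted fun ω => inner ℝ h (X ω)).map fun ω => scaledCoord ι t h (X ω)

theorem aemeasurable_scaledCoord_comp (hX : AEMeasurable X P) :
    AEMeasurable (fun ω => scaledCoord ι t h (X ω)) (P.tilted fun ω => inner ℝ h (X ω)) :=
  ((continuous_scaledCoord t).measurable.comp_aemeasurable hX).mono_ac
    (tilted_absolutelyContinuous _ _)

theorem isProbabilityMeasure_tiltedLaw (hX : AEMeasurable X P)
    (hi : Integrable (fun ω => Real.exp (inner ℝ h (X ω))) P) :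
    IsProbabilityMeasure (tiltedLaw P X t h ι) := by
  have := isProbabilityMeasure_tilted hi
  exact Measure.isProbabilityMeasure_map (aemeasurable_scaledCoord_comp hX)

/-- For `z = h + iζ` one has `∑ zᵢ² = ‖h‖² + 2i⟨h, ζ⟩ - ‖ζ‖²`. The cross term cancels the centring
by `t‖h‖²`, and orthogonality gives `t‖ζ‖² = t‖h‖²α² + ‖β‖²`. -/
theorem jointCharFun_tiltedLaw (hX : AEMeasurable X P)
    (hi : Integrable (fun ω => Real.exp (inner ℝ h (X ω))) P)
    (hι : ∀ x, x ∈ (ℝ ∙ h)ᗮ ↔ ∃ w, ι w = x) (ht : 0 < t) (α : ℝ) (β : EuclideanSpace ℝ (Fin m)) :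
    jointCharFun (tiltedLaw P X t h ι) α β =
      Complex.exp (-(((√t * ‖h‖ * α) ^ 2 + ‖β‖ ^ 2 : ℝ) : ℂ) / 2) *
        (laplaceResidue P X t 1 (toComplexVec h + Complex.I •
          toComplexVec (α • h + (√t)⁻¹ • ι β)) / laplaceResidue P X t 1 (toComplexVec h)) := by
  have hs0 : 0 < √t := Real.sqrt_pos.2 ht
  have hsq : √t ^ 2 = t := Real.sq_sqrt ht.le
  set ζ := α • h + (√t)⁻¹ • ι β with hζ
  have hmpos : 0 < ∫ ω, Real.exp (inner ℝ h (X ω)) ∂P := integral_exp_pos hi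
  set M := ∫ ω, Real.exp (inner ℝ h (X ω)) ∂P with hM
  have hsum : ∀ ω, ∑ i, (toComplexVec h + Complex.I • toComplexVec ζ) i * (X ω i : ℂ) =
      ((inner ℝ h (X ω) : ℝ) : ℂ) + Complex.I * ((inner ℝ ζ (X ω) : ℝ) : ℂ) := by
    intro ω
    rw [← sum_toComplexVec_mul, ← sum_toComplexVec_mul, Finset.mul_sum, ← Finset.sum_add_distrib]
    refine Finset.sum_congr rfl fun i _ => ?_
    simp only [Pi.add_apply, Pi.smul_apply, smul_eq_mul]
    ring
  have hhζ : inner ℝ h ζ = α * ‖h‖ ^ 2 := by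
    rw [hζ, inner_add_right, real_inner_smul_right, real_inner_smul_right,
      inner_isometry_eq_zero hι, real_inner_self_eq_norm_sq]
    ring
  have hζζ : inner ℝ ζ ζ = α ^ 2 * ‖h‖ ^ 2 + t⁻¹ * ‖β‖ ^ 2 := by
    have h1 : inner ℝ (ι β) h = 0 := by rw [real_inner_comm]; exact inner_isometry_eq_zero hι β
    simp only [hζ, inner_add_left, inner_add_right, real_inner_smul_left, real_inner_smul_right,
      inner_isometry_eq_zero hι, h1]
    simp only [real_inner_self_eq_norm_sq, ι.norm_map]
    have hinv : (√t)⁻¹ * (√t)⁻¹ = t⁻¹ := by rw [← mul_inv, Real.mul_self_sqrt ht.le]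
    linear_combination ‖β‖ ^ 2 * hinv
  have hquad : ∑ i, (toComplexVec h + Complex.I • toComplexVec ζ) i *
      (toComplexVec h + Complex.I • toComplexVec ζ) i =
      ((‖h‖ ^ 2 : ℝ) : ℂ) + 2 * Complex.I * ((α * ‖h‖ ^ 2 : ℝ) : ℂ) -
        ((α ^ 2 * ‖h‖ ^ 2 + t⁻¹ * ‖β‖ ^ 2 : ℝ) : ℂ) := by
    rw [← hζζ, ← hhζ, ← real_inner_self_eq_norm_sq, ← sum_toComplexVec_mul, ← sum_toComplexVec_mul,
      ← sum_toComplexVec_mul, Finset.mul_sum, ← Finset.sum_add_distrib, ← Finset.sum_sub_distrib]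
    refine Finset.sum_congr rfl fun i _ => ?_
    simp only [Pi.add_apply, Pi.smul_apply, smul_eq_mul, toComplexVec]
    linear_combination (ζ i : ℂ) ^ 2 * Complex.I_sq
  have hleft : jointCharFun (tiltedLaw P X t h ι) α β =
      (M : ℂ)⁻¹ * Complex.exp (-(Complex.I * (α * t * ‖h‖ ^ 2 : ℝ))) *
        ∫ ω, Complex.exp (∑ i, (toComplexVec h + Complex.I • toComplexVec ζ) i * (X ω i : ℂ)) ∂P := by
    rw [jointCharFun, tiltedLaw, integral_map (aemeasurable_scaledCoord_comp hX)
      (Continuous.aestronglyMeasurable (by fun_prop)), integral_tilted, ← integral_const_mul]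
    refine integral_congr_ae (Eventually.of_forall fun ω => ?_)
    simp only
    rw [hsum, ← hM, Complex.real_smul, scaledCoord, real_inner_smul_left, inner_coord]
    have h1 : inner ℝ ζ (X ω) = α * inner ℝ h (X ω) + (√t)⁻¹ * inner ℝ (X ω) (ι β) := by
      rw [hζ, inner_add_left, real_inner_smul_left, real_inner_smul_left, real_inner_comm (ι β) (X ω)]
    rw [h1, Complex.ofReal_div, Complex.ofReal_exp, div_eq_mul_inv, mul_comm (Complex.exp _),
      mul_assoc, mul_assoc, ← Complex.exp_add, ← Complex.exp_add]
    congr 2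
    push_cast
    ring
  have hM0 : (M : ℂ) ≠ 0 := by exact_mod_cast hmpos.ne'
  rw [hleft, laplaceResidue_toComplexVec, ← hM, laplaceResidue_one, hquad, Complex.ofReal_mul M,
    Complex.ofReal_exp]
  set J := ∫ ω, Complex.exp (∑ i, (toComplexVec h + Complex.I • toComplexVec ζ) i * (X ω i : ℂ)) ∂P
  have hE : Complex.exp (-(Complex.I * (α * t * ‖h‖ ^ 2 : ℝ))) *
      Complex.exp ((-(t * ‖h‖ ^ 2 / 2) : ℝ) : ℂ) =
      Complex.exp (-(((√t * ‖h‖ * α) ^ 2 + ‖β‖ ^ 2 : ℝ) : ℂ) / 2) *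
      Complex.exp (-((t : ℂ) * (((‖h‖ ^ 2 : ℝ) : ℂ) + 2 * Complex.I * ((α * ‖h‖ ^ 2 : ℝ) : ℂ) -
        ((α ^ 2 * ‖h‖ ^ 2 + t⁻¹ * ‖β‖ ^ 2 : ℝ) : ℂ)) / 2)) := by
    rw [← Complex.exp_add, ← Complex.exp_add]
    congr 1
    have ht0 : (t : ℂ) ≠ 0 := by exact_mod_cast ht.ne'
    rw [mul_pow, mul_pow, hsq]
    push_cast
    field_simp
    ring
  have he0 := Complex.exp_ne_zero ((-(t * ‖h‖ ^ 2 / 2) : ℝ) : ℂ)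
  rw [mul_div_assoc', eq_div_iff (mul_ne_zero hM0 he0)]
  have halg : ∀ A B C D N : ℂ, N ≠ 0 → A * B = C * D → N⁻¹ * A * J * (N * B) = C * (J * D) := by
    intro A B C D N hN hAB
    field_simp
    linear_combination J * hAB
  exact halg _ _ _ _ _ hM0 hE

/-- The probability of a cone in terms of the tilted law. -/
theorem residue_mul_measureReal_cone (hX : AEMeasurable X P)
    (hi : Integrable (fun ω => Real.exp (inner ℝ h (X ω))) P)
    (hι : ∀ x, x ∈ (ℝ ∙ h)ᗮ ↔ ∃ w, ι w = x) (hh : h ≠ 0) (ht : 0 < t)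
    {D : Set (EuclideanSpace ℝ (Fin d))} (hD : D ⊆ (ℝ ∙ h)ᗮ) (hDm : MeasurableSet D) :
    ((Real.exp (t * ‖h‖ ^ 2 / 2) : ℝ) : ℂ) * (1 / laplaceResidue P X t 1 (toComplexVec h)) *
      ((P.real {ω | X ω ∈ t • coneOver ((fun x => x + h) '' D)} : ℝ) : ℂ) =
    ((∫ x in truncatedCone (1 / (t * ‖h‖ ^ 2)) (scaledBase ι t D), Real.exp (-x.1)
      ∂(tiltedLaw P X t h ι) : ℝ) : ℂ) := by
  have hmpos : 0 < ∫ ω, Real.exp (inner ℝ h (X ω)) ∂P := integral_exp_pos hi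
  set M := ∫ ω, Real.exp (inner ℝ h (X ω)) ∂P with hM
  set B := truncatedCone (1 / (t * ‖h‖ ^ 2)) (scaledBase ι t D) with hB
  have hBm : MeasurableSet B := measurableSet_truncatedCone _ (measurableSet_scaledBase t hDm)
  have hset : {ω | X ω ∈ t • coneOver ((fun x => x + h) '' D)} =
      (fun ω => scaledCoord ι t h (X ω)) ⁻¹' B := by
    ext ω
    exact mem_smul_coneOver_iff hι hh ht hD (X ω)
  have hnull : NullMeasurableSet ((fun ω => scaledCoord ι t h (X ω)) ⁻¹' B) P :=
    ((continuous_scaledCoord t).measurable.comp_aemeasurable hX).nullMeasurable hBm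
  have hreal : P.real ((fun ω => scaledCoord ι t h (X ω)) ⁻¹' B) =
      ∫ ω, ((fun ω => scaledCoord ι t h (X ω)) ⁻¹' B).indicator (fun _ => (1 : ℝ)) ω ∂P := by
    rw [integral_indicator₀ hnull]; simp
  have hint : ∫ x in B, Real.exp (-x.1) ∂(tiltedLaw P X t h ι) =
      Real.exp (t * ‖h‖ ^ 2) / M *
        P.real {ω | X ω ∈ t • coneOver ((fun x => x + h) '' D)} := by
    rw [hset, ← integral_indicator hBm, tiltedLaw, integral_map (aemeasurable_scaledCoord_comp hX)
      ((by fun_prop : Measurable fun x : ℝ × EuclideanSpace ℝ (Fin m) =>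
        Real.exp (-x.1)).indicator hBm).aestronglyMeasurable, integral_tilted, ← hM,
      hreal, ← integral_const_mul]
    refine integral_congr_ae (Eventually.of_forall fun ω => ?_)
    by_cases hω : scaledCoord ι t h (X ω) ∈ B
    · simp only [Set.indicator_of_mem hω, smul_eq_mul]
      rw [Set.indicator_of_mem (show ω ∈ (fun ω => scaledCoord ι t h (X ω)) ⁻¹' B from hω)]
      simp only [scaledCoord, mul_one]
      rw [div_mul_eq_mul_div, ← Real.exp_add]
      congr 2
      ring
    · simp only [Set.indicator_of_notMem hω, smul_eq_mul]
      rw [Set.indicator_of_notMem (show ω ∉ (fun ω => scaledCoord ι t h (X ω)) ⁻¹' B from hω)]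
      simp
  rw [hint, laplaceResidue_toComplexVec, ← hM]
  norm_cast
  congr 1
  -- One factor is the prefactor of the statement, the other comes from inverting the Gaussian
  -- factor of the residue.
  have h1 : Real.exp (t * ‖h‖ ^ 2) = Real.exp (t * ‖h‖ ^ 2 / 2) * Real.exp (t * ‖h‖ ^ 2 / 2) := by
    rw [← Real.exp_add]; congr 1; ring
  rw [h1, Real.exp_neg]
  have := Real.exp_pos (t * ‖h‖ ^ 2 / 2)
  field_simp

end Tilting

/-! ### Expansion of the integral over the base -/

section MainTerm

variable {d m : ℕ} {t : ℝ} {h : EuclideanSpace ℝ (Fin d)}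
  {ι : EuclideanSpace ℝ (Fin m) →ₗᵢ[ℝ] EuclideanSpace ℝ (Fin d)}

theorem continuous_gradPairing (ψ : (Fin d → ℂ) → ℂ) (z : Fin d → ℂ) :
    Continuous (gradPairing ψ z) := by
  unfold gradPairing; fun_prop

/-- The substitution `x = w / √t` in dimension `d - 1` has Jacobian `t^(-(d-1)/2)`, which leaves
`t^(-1/2)` of the prefactor. -/
theorem rpow_mul_setIntegral_perpMeasure (hd : d = m + 1) (hp : perpMeasure h = Measure.map ι volume)
    (ht : 0 < t) (D : Set (EuclideanSpace ℝ (Fin d))) (Φ : EuclideanSpace ℝ (Fin d) → ℂ) :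
    ((t ^ ((d : ℝ) / 2 - 1) : ℝ) : ℂ) * ∫ x in D, Φ x ∂(perpMeasure h) =
      (((√t)⁻¹ : ℝ) : ℂ) * ∫ w in scaledBase ι t D, Φ (ι ((√t)⁻¹ • w)) := by
  have hs0 : 0 < √t := Real.sqrt_pos.2 ht
  have hemb : MeasurableEmbedding ι := ι.isometry.isClosedEmbedding.measurableEmbedding
  have hset : (√t)⁻¹ • scaledBase ι t D = ι ⁻¹' D := by
    ext w
    rw [Set.mem_smul_set_iff_inv_smul_mem₀ (inv_ne_zero hs0.ne'), inv_inv, Set.mem_preimage]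
    change ι ((√t)⁻¹ • √t • w) ∈ D ↔ _
    rw [inv_smul_smul₀ hs0.ne']
  rw [hp, hemb.setIntegral_map, Measure.setIntegral_comp_smul_of_pos volume (fun w => Φ (ι w)) _
    (inv_pos.2 hs0), hset, Complex.real_smul, ← mul_assoc, ← Complex.ofReal_mul]
  congr 2
  rw [finrank_euclideanSpace_fin, hd, inv_pow, inv_inv, Real.sqrt_eq_rpow, ← Real.rpow_neg ht.le,
    ← Real.rpow_natCast, ← Real.rpow_mul ht.le, ← Real.rpow_add ht]
  congr 1
  push_cast
  ring

theorem one_add_sq_mul_exp_le (u : ℝ) :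
    (1 + u ^ 2) * Real.exp (-(1 / 2) * u ^ 2) ≤ 4 * Real.exp (-(1 / 4) * u ^ 2) := by
  have h1 : Real.exp (-(1 / 2) * u ^ 2) = Real.exp (-(1 / 4) * u ^ 2) * Real.exp (-(1 / 4) * u ^ 2) := by
    rw [← Real.exp_add]; congr 1; ring
  have h2 : 1 + u ^ 2 ≤ 4 * Real.exp (1 / 4 * u ^ 2) := by
    have := Real.add_one_le_exp (1 / 4 * u ^ 2)
    linarith
  have h3 : Real.exp (1 / 4 * u ^ 2) * Real.exp (-(1 / 4) * u ^ 2) = 1 := by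
    rw [← Real.exp_add]; simp
  have h4 := Real.exp_pos (-(1 / 4) * u ^ 2)
  rw [h1]
  nlinarith [mul_le_mul_of_nonneg_right h2 (mul_pos h4 h4).le]

/-- The correction terms of the integrand are negligible. -/
theorem norm_mainTerm_sub_le (hh : h ≠ 0) (ht : 0 < t)
    {g : EuclideanSpace ℝ (Fin d) → ℂ} (hg : Continuous g) {c : ℝ} (hc : 0 ≤ c)
    (hgc : ∀ x, ‖g x‖ ≤ c * ‖x‖) (D : Set (EuclideanSpace ℝ (Fin m))) :
    ‖(∫ w in D, (1 + g (ι ((√t)⁻¹ • w))) * ((‖h‖ * Real.exp (-(t * ‖ι ((√t)⁻¹ • w)‖ ^ 2 / 2)) /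
        (‖h‖ ^ 2 + ‖ι ((√t)⁻¹ • w)‖ ^ 2) : ℝ) : ℂ)) -
      ((‖h‖⁻¹ * ∫ w in D, Real.exp (-(1 / 2) * ‖w‖ ^ 2) : ℝ) : ℂ)‖ ≤
    (c / (√t * ‖h‖) + 1 / (t * ‖h‖ ^ 3)) *
      ∫ w : EuclideanSpace ℝ (Fin m), 4 * Real.exp (-(1 / 4) * ‖w‖ ^ 2) := by
  have hs0 : 0 < √t := Real.sqrt_pos.2 ht
  have hpos : 0 < ‖h‖ := norm_pos_iff.2 hh
  have hnorm : ∀ w : EuclideanSpace ℝ (Fin m), ‖ι ((√t)⁻¹ • w)‖ = ‖w‖ / √t := by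
    intro w
    rw [ι.norm_map, norm_smul, norm_inv, Real.norm_of_nonneg hs0.le, inv_mul_eq_div]
  have hsq : ∀ w : EuclideanSpace ℝ (Fin m), ‖ι ((√t)⁻¹ • w)‖ ^ 2 = ‖w‖ ^ 2 / t := by
    intro w
    rw [hnorm, div_pow, Real.sq_sqrt ht.le]
  set f : EuclideanSpace ℝ (Fin m) → ℂ := fun w => (1 + g (ι ((√t)⁻¹ • w))) *
    ((‖h‖ * Real.exp (-(t * ‖ι ((√t)⁻¹ • w)‖ ^ 2 / 2)) /
        (‖h‖ ^ 2 + ‖ι ((√t)⁻¹ • w)‖ ^ 2) : ℝ) : ℂ) with hf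
  set e : EuclideanSpace ℝ (Fin m) → ℂ := fun w =>
    ((‖h‖⁻¹ * Real.exp (-(1 / 2) * ‖w‖ ^ 2) : ℝ) : ℂ) with he
  have hfc : Continuous f := by
    have hι := ι.continuous
    simp only [hf]
    refine Continuous.mul (by fun_prop) (Complex.continuous_ofReal.comp ?_)
    refine Continuous.div (by fun_prop) (by fun_prop) fun w => ?_
    positivity
  have hec : Continuous e := by
    simp only [he]
    fun_prop
  have hbound : ∀ w, ‖f w - e w‖ ≤ (c / (√t * ‖h‖) + 1 / (t * ‖h‖ ^ 3)) *
      (4 * Real.exp (-(1 / 4) * ‖w‖ ^ 2)) := by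
    intro w
    set E : ℝ := Real.exp (-(1 / 2) * ‖w‖ ^ 2) with hE
    have hE0 : 0 < E := Real.exp_pos _
    have hq : 0 ≤ ‖w‖ ^ 2 / t := by positivity
    have hexp : Real.exp (-(t * ‖ι ((√t)⁻¹ • w)‖ ^ 2 / 2)) = E := by
      rw [hsq, hE]
      congr 1
      field_simp
    -- With `q = ‖w‖²/t`, this uses `1/‖h‖ = ‖h‖/(‖h‖² + q) + q/(‖h‖(‖h‖² + q))`: the gradient part
    -- is `O(1/√t)`, the change of denominator `O(1/t)`.
    have hfe : f w - e w = g (ι ((√t)⁻¹ • w)) * ((‖h‖ * E / (‖h‖ ^ 2 + ‖w‖ ^ 2 / t) : ℝ) : ℂ) -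
        ((‖w‖ ^ 2 / t * E / (‖h‖ * (‖h‖ ^ 2 + ‖w‖ ^ 2 / t)) : ℝ) : ℂ) := by
      have h1 : ‖h‖⁻¹ * E = ‖h‖ * E / (‖h‖ ^ 2 + ‖w‖ ^ 2 / t) +
          ‖w‖ ^ 2 / t * E / (‖h‖ * (‖h‖ ^ 2 + ‖w‖ ^ 2 / t)) := by
        have : ‖h‖ ^ 2 + ‖w‖ ^ 2 / t ≠ 0 := by positivity
        field_simp
      simp only [hf, he]
      rw [hexp, hsq, ← hE, h1, Complex.ofReal_add]
      ring
    have hb1 : ‖g (ι ((√t)⁻¹ • w)) * ((‖h‖ * E / (‖h‖ ^ 2 + ‖w‖ ^ 2 / t) : ℝ) : ℂ)‖ ≤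
        c / (√t * ‖h‖) * ((1 + ‖w‖ ^ 2) * E) := by
      rw [norm_mul, Complex.norm_real, Real.norm_of_nonneg (by positivity)]
      have h1 : ‖g (ι ((√t)⁻¹ • w))‖ ≤ c * ((1 + ‖w‖ ^ 2) / √t) := by
        refine (hgc _).trans ?_
        rw [hnorm]
        gcongr
        nlinarith [sq_nonneg (‖w‖ - 1)]
      have h2 : ‖h‖ * E / (‖h‖ ^ 2 + ‖w‖ ^ 2 / t) ≤ E / ‖h‖ := by
        rw [div_le_div_iff₀ (by positivity) hpos]
        nlinarith [mul_nonneg hE0.le hq]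
      refine (mul_le_mul h1 h2 (by positivity) (by positivity)).trans (le_of_eq ?_)
      field_simp
    have hb2 : ‖((‖w‖ ^ 2 / t * E / (‖h‖ * (‖h‖ ^ 2 + ‖w‖ ^ 2 / t)) : ℝ) : ℂ)‖ ≤
        1 / (t * ‖h‖ ^ 3) * ((1 + ‖w‖ ^ 2) * E) := by
      rw [Complex.norm_real, Real.norm_of_nonneg (by positivity)]
      calc ‖w‖ ^ 2 / t * E / (‖h‖ * (‖h‖ ^ 2 + ‖w‖ ^ 2 / t))
          ≤ (1 + ‖w‖ ^ 2) / t * E / (‖h‖ * ‖h‖ ^ 2) := by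
            gcongr <;> linarith
        _ = _ := by field_simp
    have hb3 := one_add_sq_mul_exp_le ‖w‖
    rw [hfe]
    refine (norm_sub_le _ _).trans ((add_le_add hb1 hb2).trans ?_)
    rw [← add_mul]
    gcongr
  have hdom : Integrable fun w : EuclideanSpace ℝ (Fin m) =>
      (c / (√t * ‖h‖) + 1 / (t * ‖h‖ ^ 3)) * (4 * Real.exp (-(1 / 4) * ‖w‖ ^ 2)) :=
    ((integrable_exp_neg_mul_norm_sq (by norm_num)).const_mul _).const_mul _
  have hdiff : Integrable fun w => f w - e w :=
    hdom.mono' (hfc.sub hec).aestronglyMeasurable (Eventually.of_forall hbound)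
  have hei : Integrable e :=
    ((integrable_exp_neg_half_mul_norm_sq (F := EuclideanSpace ℝ (Fin m))).const_mul _).ofReal
  have hfi : Integrable f := (hdiff.add hei).congr (Eventually.of_forall fun w => by simp)
  have heq : ((‖h‖⁻¹ * ∫ w in D, Real.exp (-(1 / 2) * ‖w‖ ^ 2) : ℝ) : ℂ) = ∫ w in D, e w := by
    simp only [he]
    rw [integral_complex_ofReal, integral_const_mul]
  rw [heq, ← integral_sub hfi.integrableOn hei.integrableOn, ← integral_const_mul]
  refine (norm_integral_le_integral_norm _).trans ?_
  refine (setIntegral_le_integral hdiff.norm (Eventually.of_forall fun w => norm_nonneg _)).trans ?_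
  exact integral_mono hdiff.norm hdom hbound

end MainTerm

/-! ### From uniform smallness to one error sequence -/

section Uniformity

/-- The witness is the supremum over the index, truncated at zero since `e` may be negative. A real
supremum dominates only when the family is bounded above, hence the eventual conclusion. -/
theorem exists_tendsto_zero_of_forall_eventually_le {I : Type*} {e : ℕ → I → ℝ}
    (he : ∀ ε > 0, ∀ᶠ n in atTop, ∀ i, e n i ≤ ε) :
    ∃ δ : ℕ → ℝ, Tendsto δ atTop (𝓝 0) ∧ ∀ᶠ n in atTop, ∀ i, e n i ≤ δ n := by
  refine ⟨fun n => max 0 (⨆ i, e n i), ?_, ?_⟩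
  · rw [Metric.tendsto_nhds]
    intro ε hε
    filter_upwards [he (ε / 2) (by positivity)] with n hn
    have h1 : ⨆ i, e n i ≤ ε / 2 := Real.iSup_le hn (by positivity)
    rw [Real.dist_eq, sub_zero, abs_of_nonneg (le_max_left _ _)]
    exact max_lt hε (by linarith)
  · filter_upwards [he 1 one_pos] with n hn i
    refine le_max_of_le_right (le_ciSup ⟨1, ?_⟩ i)
    rintro _ ⟨j, rfl⟩
    exact hn j

end Uniformity

/-! ### Leading term along convergent tilting directions -/

section Asymptotics

variable {d : ℕ} {Ω : ℕ → Type*} [∀ n, MeasurableSpace (Ω n)]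
    {P : ∀ n, Measure (Ω n)} [∀ n, IsProbabilityMeasure (P n)]
    {X : ∀ n, Ω n → EuclideanSpace ℝ (Fin d)} {t : ℕ → ℝ} {a b : Fin d → EReal}
    {ψ : (Fin d → ℂ) → ℂ}

theorem add_I_smul_mem_multiStrip {h : EuclideanSpace ℝ (Fin d)} (hh : h ∈ realBox a b)
    (ζ : EuclideanSpace ℝ (Fin d)) :
    toComplexVec h + Complex.I • toComplexVec ζ ∈ multiStrip a b := by
  intro i
  simpa [toComplexVec] using hh i

/-- Residues at convergent points of the strip converge. -/
theorem tendsto_laplaceResidue_comp (hmod : IsModGaussian P X t 1 a b ψ) {n : ℕ → ℕ}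
    (hn : Tendsto n atTop atTop) {z : ℕ → Fin d → ℂ} {z₀ : Fin d → ℂ} (hz : ∀ k, z k ∈ multiStrip a b)
    (hz₀ : z₀ ∈ multiStrip a b) (hlim : Tendsto z atTop (𝓝 z₀)) :
    Tendsto (fun k => laplaceResidue (P (n k)) (X (n k)) (t (n k)) 1 (z k)) atTop (𝓝 (ψ z₀)) := by
  refine tendsto_comp_of_locally_uniform_limit_within
    (F := fun k z => laplaceResidue (P (n k)) (X (n k)) (t (n k)) 1 z)
    (hmod.continuousOn z₀ hz₀) (tendsto_nhdsWithin_iff.2 ⟨hlim, Eventually.of_forall hz⟩) ?_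
  intro u hu
  obtain ⟨s, hs, hs'⟩ := hmod.tendsto_residue u hu z₀ hz₀
  exact ⟨s, hs, hn.eventually hs'⟩

/-- Residues are eventually bounded on compact tubes over compact subsets of the real part. -/
theorem exists_eventually_norm_laplaceResidue_le (hmod : IsModGaussian P X t 1 a b ψ)
    {K : Set (EuclideanSpace ℝ (Fin d))} (hK : IsCompact K) (hKbox : K ⊆ realBox a b) (R : ℝ) :
    ∃ c : ℝ, ∀ᶠ n in atTop, ∀ h ∈ K, ∀ ζ : EuclideanSpace ℝ (Fin d), ‖ζ‖ ≤ R →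
      ‖laplaceResidue (P n) (X n) (t n) 1 (toComplexVec h + Complex.I • toComplexVec ζ)‖ ≤ c := by
  set S : Set (Fin d → ℂ) := (fun p : EuclideanSpace ℝ (Fin d) × EuclideanSpace ℝ (Fin d) =>
    toComplexVec p.1 + Complex.I • toComplexVec p.2) '' (K ×ˢ Metric.closedBall 0 R) with hS
  have hcont := continuous_toComplexVec (d := d)
  have hSc : IsCompact S := (hK.prod (isCompact_closedBall _ _)).image (by fun_prop)
  have hSs : S ⊆ multiStrip a b := by
    rintro _ ⟨p, hp, rfl⟩
    exact add_I_smul_mem_multiStrip (hKbox hp.1) _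
  obtain ⟨c, hc⟩ := hSc.exists_bound_of_continuousOn (hmod.continuousOn.mono hSs)
  have hunif := (tendstoLocallyUniformlyOn_iff_forall_isCompact (isOpen_multiStrip a b)).1
    hmod.tendsto_residue S hSs hSc
  refine ⟨c + 1, ?_⟩
  filter_upwards [Metric.tendstoUniformlyOn_iff.1 hunif 1 one_pos] with n hn h hh ζ hζ
  have hmem : toComplexVec h + Complex.I • toComplexVec ζ ∈ S :=
    ⟨(h, ζ), ⟨hh, by simpa using hζ⟩, rfl⟩
  have h1 := hn _ hmem
  rw [dist_comm, dist_eq_norm] at h1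
  have h2 := hc _ hmem
  have h3 := norm_le_norm_add_norm_sub' (laplaceResidue (P n) (X n) (t n) 1
    (toComplexVec h + Complex.I • toComplexVec ζ)) (ψ (toComplexVec h + Complex.I • toComplexVec ζ))
  linarith

/-- The asymptotics of cone probabilities along a sequence of parameters. -/
theorem tendsto_cone_asymptotics (hX : ∀ n, AEMeasurable (X n) (P n))
    (hmod : IsModGaussian P X t 1 a b ψ) (hψ : ∀ x ∈ realBox a b, ψ (toComplexVec x) ≠ 0)
    {K : Set (EuclideanSpace ℝ (Fin d))} (hK : IsCompact K) (hKbox : K ⊆ realBox a b)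
    {n : ℕ → ℕ} (hn : Tendsto n atTop atTop) (ht : ∀ k, 0 < t (n k))
    {h : ℕ → EuclideanSpace ℝ (Fin d)} (hhK : ∀ k, h k ∈ K) (hh0 : ∀ k, h k ≠ 0)
    {h₀ : EuclideanSpace ℝ (Fin d)} (hh₀K : h₀ ∈ K) (hh₀ : h₀ ≠ 0) (hlim : Tendsto h atTop (𝓝 h₀))
    {m : ℕ} (hd : d = m + 1) {ι : ℕ → EuclideanSpace ℝ (Fin m) →ₗᵢ[ℝ] EuclideanSpace ℝ (Fin d)}
    (hι : ∀ k, ∀ x, x ∈ (ℝ ∙ h k)ᗮ ↔ ∃ w, ι k w = x)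
    {D : ℕ → Set (EuclideanSpace ℝ (Fin d))}
    (hDc : ∀ k, Convex ℝ (D k)) (hDm : ∀ k, MeasurableSet (D k)) :
    Tendsto (fun k => √(t (n k)) * ((2 * Real.pi) ^ ((d : ℝ) / 2) *
      ∫ x in truncatedCone (1 / (t (n k) * ‖h k‖ ^ 2)) (scaledBase (ι k) (t (n k)) (D k)),
        Real.exp (-x.1) ∂(tiltedLaw (P (n k)) (X (n k)) (t (n k)) (h k) (ι k))) -
      ‖h k‖⁻¹ * ∫ w in scaledBase (ι k) (t (n k)) (D k), Real.exp (-(1 / 2) * ‖w‖ ^ 2))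
      atTop (𝓝 0) := by
  have hint : ∀ k, Integrable (fun ω => Real.exp (inner ℝ (h k) (X (n k) ω))) (P (n k)) := fun k =>
    integrable_exp_inner (hmod.integrable _ _ (toComplexVec_mem_multiStrip (hKbox (hhK k))))
  have hprob : ∀ k, IsProbabilityMeasure (tiltedLaw (P (n k)) (X (n k)) (t (n k)) (h k) (ι k)) :=
    fun k => isProbabilityMeasure_tiltedLaw (hX _) (hint k)
  have htn : Tendsto (fun k => t (n k)) atTop atTop := hmod.tendsto_param.comp hn
  have hst : Tendsto (fun k => √(t (n k))) atTop atTop := Real.tendsto_sqrt_atTop.comp htn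
  have hnpos : 0 < ‖h₀‖ := norm_pos_iff.2 hh₀
  have hσ : Tendsto (fun k => √(t (n k)) * ‖h k‖) atTop atTop :=
    hst.atTop_mul_pos hnpos hlim.norm
  have hcont := continuous_toComplexVec (d := d)
  have hz₀ : toComplexVec h₀ ∈ multiStrip a b := toComplexVec_mem_multiStrip (hKbox hh₀K)
  have hden : Tendsto (fun k => laplaceResidue (P (n k)) (X (n k)) (t (n k)) 1 (toComplexVec (h k)))
      atTop (𝓝 (ψ (toComplexVec h₀))) :=
    tendsto_laplaceResidue_comp hmod hn
      (fun k => toComplexVec_mem_multiStrip (hKbox (hhK k))) hz₀ ((hcont.tendsto _).comp hlim)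
  have hψ₀ := hψ h₀ (hKbox hh₀K)
  have hbdd : ∀ R : ℝ, ∃ c : ℝ, ∀ᶠ k in atTop, ∀ (α : ℝ) (β : EuclideanSpace ℝ (Fin m)),
      |α| ≤ R → ‖β‖ ≤ R → ‖laplaceResidue (P (n k)) (X (n k)) (t (n k)) 1
        (toComplexVec (h k) + Complex.I • toComplexVec (α • h k + (√(t (n k)))⁻¹ • ι k β)) /
        laplaceResidue (P (n k)) (X (n k)) (t (n k)) 1 (toComplexVec (h k))‖ ≤ c := by
    intro R
    -- Once `‖h k‖ ≤ ‖h₀‖ + 1` and `√t ≥ 1`, this radius bounds `|α| ‖h k‖ + ‖β‖ / √t`.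
    obtain ⟨c, hc⟩ := exists_eventually_norm_laplaceResidue_le hmod hK hKbox
      (R * (‖h₀‖ + 1) + R)
    have hψpos : 0 < ‖ψ (toComplexVec h₀)‖ := norm_pos_iff.2 hψ₀
    refine ⟨c / (‖ψ (toComplexVec h₀)‖ / 2), ?_⟩
    filter_upwards [hn.eventually hc, hst.eventually_ge_atTop 1,
      hlim.norm.eventually_le_const (lt_add_one ‖h₀‖),
      hden.norm.eventually_const_le (half_lt_self hψpos)] with k hk1 hk2 hk3 hk4 α β hα hβ
    have hR : 0 ≤ R := (abs_nonneg _).trans hα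
    have hζ : ‖α • h k + (√(t (n k)))⁻¹ • ι k β‖ ≤ R * (‖h₀‖ + 1) + R := by
      refine (norm_add_le _ _).trans (add_le_add ?_ ?_)
      · rw [norm_smul, Real.norm_eq_abs]
        exact mul_le_mul hα hk3 (norm_nonneg _) hR
      · rw [norm_smul, norm_inv, Real.norm_of_nonneg (by positivity), (ι k).norm_map]
        exact (mul_le_of_le_one_left (norm_nonneg _) (inv_le_one_of_one_le₀ hk2)).trans hβ
    have h1 := hk1 (h k) (hhK k) _ hζ
    rw [norm_div]
    exact div_le_div₀ ((norm_nonneg _).trans h1) h1 (by positivity) hk4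
  have hratio : ∀ (β : EuclideanSpace ℝ (Fin m)) (α : ℕ → ℝ), Tendsto α atTop (𝓝 0) →
      Tendsto (fun k => laplaceResidue (P (n k)) (X (n k)) (t (n k)) 1
        (toComplexVec (h k) + Complex.I • toComplexVec (α k • h k + (√(t (n k)))⁻¹ • ι k β)) /
        laplaceResidue (P (n k)) (X (n k)) (t (n k)) 1 (toComplexVec (h k))) atTop (𝓝 1) := by
    intro β α hα
    have hζ : Tendsto (fun k => α k • h k + (√(t (n k)))⁻¹ • ι k β) atTop (𝓝 0) := by
      rw [← add_zero (0 : EuclideanSpace ℝ (Fin d))]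
      refine Tendsto.add ?_ ?_
      · simpa using hα.smul hlim
      · rw [tendsto_zero_iff_norm_tendsto_zero]
        have : Tendsto (fun k => (√(t (n k)))⁻¹ * ‖β‖) atTop (𝓝 0) := by
          simpa using (tendsto_inv_atTop_zero.comp hst).mul_const ‖β‖
        refine this.congr fun k => ?_
        rw [norm_smul, norm_inv, Real.norm_of_nonneg (Real.sqrt_nonneg _), (ι k).norm_map]
    have hzero : toComplexVec (0 : EuclideanSpace ℝ (Fin d)) = 0 := by ext i; simp [toComplexVec]
    have hz : Tendsto (fun k => toComplexVec (h k) + Complex.I •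
        toComplexVec (α k • h k + (√(t (n k)))⁻¹ • ι k β)) atTop (𝓝 (toComplexVec h₀)) := by
      have := ((hcont.tendsto _).comp hlim).add (((hcont.tendsto _).comp hζ).const_smul Complex.I)
      rw [hzero, smul_zero, add_zero] at this
      exact this
    have hnum := tendsto_laplaceResidue_comp hmod hn
      (fun k => add_I_smul_mem_multiStrip (hKbox (hhK k)) _) hz₀ hz
    have := hnum.div hden hψ₀
    rwa [div_self hψ₀] at this
  have hη0 : ∀ k, 0 ≤ 1 / (t (n k) * ‖h k‖ ^ 2) := fun k => by have := ht k; positivity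
  have hη : Tendsto (fun k => 1 / (t (n k) * ‖h k‖ ^ 2)) atTop (𝓝 0) :=
    (htn.atTop_mul_pos (pow_pos hnpos 2) (hlim.norm.pow 2)).const_div_atTop 1
  have hDm' : ∀ k, MeasurableSet (scaledBase (ι k) (t (n k)) (D k)) := fun k =>
    measurableSet_scaledBase _ (hDm k)
  have hA := tendsto_mul_setIntegral_exp_neg_sub hσ
    (fun k α β => jointCharFun_tiltedLaw (hX (n k)) (hint k) (hι k) (ht k) α β) hbdd hratio
    (fun k => convex_truncatedCone (hη0 k) (convex_scaledBase (t (n k)) (hDc k)))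
    (fun k => measurableSet_truncatedCone _ (hDm' k)) (fun k x hx => hx.1)
  have hB := tendsto_setIntegral_truncatedCone_sub hη0 hη hDm'
  -- Division by `‖h k‖` reduces `σ = √t ‖h k‖` to `√t` and creates the factor `‖h k‖⁻¹`; the powers
  -- of `2π` cancel since `d = m + 1`.
  have hfin := (hlim.norm.inv₀ hnpos.ne').mul ((hA.const_mul ((2 * Real.pi) ^ ((d : ℝ) / 2))).add hB)
  rw [mul_zero, add_zero, mul_zero] at hfin
  refine hfin.congr fun k => ?_
  have hk : ‖h k‖ ≠ 0 := norm_ne_zero_iff.2 (hh0 k)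
  have hpow : (2 * Real.pi) ^ ((d : ℝ) / 2) *
      (2 * Real.pi) ^ (-((Module.finrank ℝ (EuclideanSpace ℝ (Fin m)) : ℝ) + 1) / 2) = 1 := by
    have hexp : ((m + 1 : ℕ) : ℝ) / 2 + -((m : ℝ) + 1) / 2 = 0 := by push_cast; ring
    rw [← Real.rpow_add (by positivity), finrank_euclideanSpace_fin, hd, hexp, Real.rpow_zero]
  rw [mul_sub, ← mul_assoc _ ((2 * Real.pi) ^ (-((Module.finrank ℝ (EuclideanSpace ℝ (Fin m)) : ℝ) + 1) / 2)),
    hpow]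
  field_simp
  ring

end Asymptotics

/-! ### Uniformity by contradiction and conclusion -/

theorem mainTheorem9 {d : ℕ} {Ω : ℕ → Type*} [∀ n, MeasurableSpace (Ω n)]
    (P : ∀ n, Measure (Ω n)) [∀ n, IsProbabilityMeasure (P n)]
    (X : ∀ n, Ω n → EuclideanSpace ℝ (Fin d)) (hX : ∀ n, AEMeasurable (X n) (P n))
    (t : ℕ → ℝ) (a b : Fin d → EReal) (ha : ∀ i, a i < 0) (hb : ∀ i, 0 < b i)
    (ψ : (Fin d → ℂ) → ℂ) (hmod : IsModGaussian P X t 1 a b ψ)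
    (hψ : ∀ x ∈ realBox a b, ψ (toComplexVec x) ≠ 0)
    (K : Set (EuclideanSpace ℝ (Fin d))) (hK : IsCompact K) (hKbox : K ⊆ realBox a b)
    (hK0 : 0 ∉ K) (M : ℝ) :
    ∃ (c : ℝ) (r : ℕ → EuclideanSpace ℝ (Fin d) → EuclideanSpace ℝ (Fin d) → ℝ) (δ : ℕ → ℝ),
      Tendsto δ atTop (𝓝 0) ∧
      (∀ n, ∀ h ∈ K, Measurable (r n h)) ∧
      ∀ᶠ n in atTop,
        (∀ h ∈ K, ∀ x ∈ (ℝ ∙ h)ᗮ, ‖x‖ ≤ M → |r n h x| ≤ c / t n) ∧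
        ∀ h ∈ K, ∀ D₀ : Set (EuclideanSpace ℝ (Fin d)),
          D₀ ⊆ (ℝ ∙ h)ᗮ → Convex ℝ D₀ → MeasurableSet D₀ → (∀ x ∈ D₀, ‖x‖ ≤ M) →
          ‖(((2 * Real.pi) ^ ((d : ℝ) / 2) * Real.exp (t n * ‖h‖ ^ 2 / 2) : ℝ) : ℂ) *
                (1 / laplaceResidue (P n) (X n) (t n) 1 (toComplexVec h)) *
                (((P n).real {ω | X n ω ∈ t n • coneOver ((fun x => x + h) '' D₀)} : ℝ) : ℂ) -
              ((t n ^ ((d : ℝ) / 2 - 1) : ℝ) : ℂ) *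
                ∫ x in D₀,
                  (1 + gradPairing ψ (toComplexVec h) x / ψ (toComplexVec h) + (r n h x : ℂ)) *
                    ((‖h‖ * Real.exp (-(t n * ‖x‖ ^ 2 / 2)) / (‖h‖ ^ 2 + ‖x‖ ^ 2) : ℝ) : ℂ)
                  ∂(perpMeasure h)‖ ≤ δ n / √(t n) := by
  let I := {p : EuclideanSpace ℝ (Fin d) × Set (EuclideanSpace ℝ (Fin d)) //
    p.1 ∈ K ∧ p.2 ⊆ (ℝ ∙ p.1)ᗮ ∧ Convex ℝ p.2 ∧ MeasurableSet p.2}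
  -- The error for the correction `r = 0`, multiplied by `√t`.
  let e : ℕ → I → ℝ := fun n p => √(t n) *
    ‖(((2 * Real.pi) ^ ((d : ℝ) / 2) * Real.exp (t n * ‖p.1.1‖ ^ 2 / 2) : ℝ) : ℂ) *
        (1 / laplaceResidue (P n) (X n) (t n) 1 (toComplexVec p.1.1)) *
        (((P n).real {ω | X n ω ∈ t n • coneOver ((fun x => x + p.1.1) '' p.1.2)} : ℝ) : ℂ) -
      ((t n ^ ((d : ℝ) / 2 - 1) : ℝ) : ℂ) *
        ∫ x in p.1.2, (1 + gradPairing ψ (toComplexVec p.1.1) x / ψ (toComplexVec p.1.1)) *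
          ((‖p.1.1‖ * Real.exp (-(t n * ‖x‖ ^ 2 / 2)) / (‖p.1.1‖ ^ 2 + ‖x‖ ^ 2) : ℝ) : ℂ)
          ∂(perpMeasure p.1.1)‖
  have he : ∀ ε > 0, ∀ᶠ n in atTop, ∀ i, e n i ≤ ε := by
    intro ε hε
    -- A failure gives indices, directions and bases violating the bound. Only the directions need
    -- to converge, by compactness of `K`: the asymptotics hold for arbitrary sequences of convex
    -- bases.
    by_contra hcon
    rw [not_eventually] at hcon
    obtain ⟨n, hnmono, hn⟩ := extraction_of_frequently_atTop
      (hcon.and_eventually (hmod.tendsto_param.eventually_gt_atTop 0))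
    have hex : ∀ k, ∃ i, ε < e (n k) i := fun k => by
      have := (hn k).1
      push Not at this
      exact this
    choose i hi using hex
    obtain ⟨h₀, hh₀K, φ, hφ, hlim⟩ := hK.tendsto_subseq (x := fun k => (i k).1.1) fun k => (i k).2.1
    have hne : ∀ x ∈ K, x ≠ 0 := fun x hx h0 => hK0 (h0 ▸ hx)
    -- In dimension zero the only vector is `0`, which is excluded from `K`.
    have hd0 : d ≠ 0 := by
      rintro rfl
      exact hne h₀ hh₀K (Subsingleton.elim _ _)
    obtain ⟨m, hd⟩ := Nat.exists_eq_succ_of_ne_zero hd0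
    set n' : ℕ → ℕ := fun k => n (φ k) with hn'
    set h : ℕ → EuclideanSpace ℝ (Fin d) := fun k => (i (φ k)).1.1 with hh
    set D : ℕ → Set (EuclideanSpace ℝ (Fin d)) := fun k => (i (φ k)).1.2 with hD
    have hhK : ∀ k, h k ∈ K := fun k => (i (φ k)).2.1
    have hh0 : ∀ k, h k ≠ 0 := fun k => hne _ (hhK k)
    have hDsub : ∀ k, D k ⊆ (ℝ ∙ h k)ᗮ := fun k => (i (φ k)).2.2.1
    have hDm : ∀ k, MeasurableSet (D k) := fun k => (i (φ k)).2.2.2.2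
    have hnt : Tendsto n' atTop atTop := hnmono.tendsto_atTop.comp hφ.tendsto_atTop
    have ht : ∀ k, 0 < t (n' k) := fun k => (hn (φ k)).2
    choose ι hι hp using fun k => exists_isometry_orthogonal (m := m) hd (hh0 k)
    obtain ⟨c, hc0, hc⟩ := exists_norm_gradPairing_div_le hmod hψ hK hKbox
    have hmain := tendsto_cone_asymptotics hX hmod hψ hK hKbox hnt ht hhK hh0 hh₀K (hne _ hh₀K) hlim
      hd hι (D := D) (fun k => (i (φ k)).2.2.2.1) hDm
    set J : ℝ := ∫ w : EuclideanSpace ℝ (Fin m), 4 * Real.exp (-(1 / 4) * ‖w‖ ^ 2) with hJ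
    have htn : Tendsto (fun k => t (n' k)) atTop atTop := hmod.tendsto_param.comp hnt
    have hnpos : 0 < ‖h₀‖ := norm_pos_iff.2 (hne _ hh₀K)
    have hcor : Tendsto (fun k => (c / (√(t (n' k)) * ‖h k‖) + 1 / (t (n' k) * ‖h k‖ ^ 3)) * J)
        atTop (𝓝 0) := by
      have h1 := (((Real.tendsto_sqrt_atTop.comp htn).atTop_mul_pos hnpos
        hlim.norm).const_div_atTop c).add
        ((htn.atTop_mul_pos (pow_pos hnpos 3) (hlim.norm.pow 3)).const_div_atTop 1)
      simpa using h1.mul_const J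
    have hbound : ∀ k, e (n' k) (i (φ k)) ≤
        |√(t (n' k)) * ((2 * Real.pi) ^ ((d : ℝ) / 2) *
          ∫ x in truncatedCone (1 / (t (n' k) * ‖h k‖ ^ 2)) (scaledBase (ι k) (t (n' k)) (D k)),
            Real.exp (-x.1) ∂(tiltedLaw (P (n' k)) (X (n' k)) (t (n' k)) (h k) (ι k))) -
          ‖h k‖⁻¹ * ∫ w in scaledBase (ι k) (t (n' k)) (D k), Real.exp (-(1 / 2) * ‖w‖ ^ 2)| +
        (c / (√(t (n' k)) * ‖h k‖) + 1 / (t (n' k) * ‖h k‖ ^ 3)) * J := by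
      intro k
      have hint : Integrable (fun ω => Real.exp (inner ℝ (h k) (X (n' k) ω))) (P (n' k)) :=
        integrable_exp_inner (hmod.integrable _ _ (toComplexVec_mem_multiStrip (hKbox (hhK k))))
      have hs0 : 0 < √(t (n' k)) := Real.sqrt_pos.2 (ht k)
      have hcone := residue_mul_measureReal_cone (hX (n' k)) hint (hι k) (hh0 k) (ht k) (hDsub k)
        (hDm k)
      have hterm := norm_mainTerm_sub_le (ι := ι k) (hh0 k) (ht k)
        (g := fun x => gradPairing ψ (toComplexVec (h k)) x / ψ (toComplexVec (h k)))
        ((continuous_gradPairing _ _).div_const _) hc0 (hc _ (hhK k))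
        (scaledBase (ι k) (t (n' k)) (D k))
      change √(t (n' k)) *
        ‖(((2 * Real.pi) ^ ((d : ℝ) / 2) * Real.exp (t (n' k) * ‖h k‖ ^ 2 / 2) : ℝ) : ℂ) *
          (1 / laplaceResidue (P (n' k)) (X (n' k)) (t (n' k)) 1 (toComplexVec (h k))) *
          (((P (n' k)).real {ω | X (n' k) ω ∈ t (n' k) • coneOver ((fun x => x + h k) '' D k)} : ℝ)
            : ℂ) - ((t (n' k) ^ ((d : ℝ) / 2 - 1) : ℝ) : ℂ) *
        ∫ x in D k, (1 + gradPairing ψ (toComplexVec (h k)) x / ψ (toComplexVec (h k))) *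
          ((‖h k‖ * Real.exp (-(t (n' k) * ‖x‖ ^ 2 / 2)) / (‖h k‖ ^ 2 + ‖x‖ ^ 2) : ℝ) : ℂ)
          ∂(perpMeasure (h k))‖ ≤ _
      rw [Complex.ofReal_mul, mul_assoc, mul_assoc, ← mul_assoc ((Real.exp _ : ℝ) : ℂ), hcone,
        rpow_mul_setIntegral_perpMeasure hd (hp k) (ht k)]
      set L : ℝ := ∫ x in truncatedCone (1 / (t (n' k) * ‖h k‖ ^ 2))
        (scaledBase (ι k) (t (n' k)) (D k)), Real.exp (-x.1)
          ∂(tiltedLaw (P (n' k)) (X (n' k)) (t (n' k)) (h k) (ι k))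
      set G : ℝ := ‖h k‖⁻¹ * ∫ w in scaledBase (ι k) (t (n' k)) (D k), Real.exp (-(1 / 2) * ‖w‖ ^ 2)
      set N : ℂ := ∫ w in scaledBase (ι k) (t (n' k)) (D k),
        (1 + gradPairing ψ (toComplexVec (h k)) (ι k ((√(t (n' k)))⁻¹ • w)) /
          ψ (toComplexVec (h k))) * ((‖h k‖ *
          Real.exp (-(t (n' k) * ‖ι k ((√(t (n' k)))⁻¹ • w)‖ ^ 2 / 2)) /
            (‖h k‖ ^ 2 + ‖ι k ((√(t (n' k)))⁻¹ • w)‖ ^ 2) : ℝ) : ℂ)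
      have hs0' : ((√(t (n' k)) : ℝ) : ℂ) ≠ 0 := by exact_mod_cast hs0.ne'
      calc √(t (n' k)) * ‖(((2 * Real.pi) ^ ((d : ℝ) / 2) : ℝ) : ℂ) * (L : ℂ) -
            (((√(t (n' k)))⁻¹ : ℝ) : ℂ) * N‖
          -- Insert the Gaussian mass `G`, the common leading term of both sides.
          = ‖((√(t (n' k)) * ((2 * Real.pi) ^ ((d : ℝ) / 2) * L) - G : ℝ) : ℂ) - (N - (G : ℂ))‖ := by
            have hnorm : ‖((√(t (n' k)) : ℝ) : ℂ)‖ = √(t (n' k)) := by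
              rw [Complex.norm_real, Real.norm_of_nonneg hs0.le]
            have halg : ((√(t (n' k)) * ((2 * Real.pi) ^ ((d : ℝ) / 2) * L) - G : ℝ) : ℂ) -
                (N - (G : ℂ)) = ((√(t (n' k)) : ℝ) : ℂ) *
                  ((((2 * Real.pi) ^ ((d : ℝ) / 2) : ℝ) : ℂ) * (L : ℂ) -
                    (((√(t (n' k)))⁻¹ : ℝ) : ℂ) * N) := by
              rw [mul_sub, ← mul_assoc _ _ N, Complex.ofReal_inv, mul_inv_cancel₀ hs0',
                Complex.ofReal_sub, Complex.ofReal_mul, Complex.ofReal_mul]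
              ring
            rw [halg, norm_mul, hnorm]
        _ ≤ _ := by
            refine (norm_sub_le _ _).trans (add_le_add ?_ hterm)
            rw [Complex.norm_real, Real.norm_eq_abs]
    have hzero := hmain.abs.add hcor
    rw [abs_zero, add_zero] at hzero
    obtain ⟨k, hk⟩ := (hzero.eventually_lt_const hε).exists
    exact lt_irrefl _ (((hi (φ k)).trans_le (hbound k)).trans hk)
  obtain ⟨δ, hδ, hδe⟩ := exists_tendsto_zero_of_forall_eventually_le he
  -- An `O(1/t)` correction inside the integral changes the right side by only `O(t^(-3/2))`, so it
  -- can be taken to be zero.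
  refine ⟨0, fun _ _ _ => 0, δ, hδ, fun _ _ _ => measurable_const, ?_⟩
  filter_upwards [hδe, hmod.tendsto_param.eventually_gt_atTop 0] with n hn ht
  refine ⟨fun h _ x _ _ => by simp, fun h hh D₀ hD hDc hDm _ => ?_⟩
  have := hn ⟨(h, D₀), hh, hD, hDc, hDm⟩
  rw [le_div_iff₀ (Real.sqrt_pos.2 ht), mul_comm]
  simpa only [Complex.ofReal_zero, add_zero] using this
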